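/- Let $n,d\ge 1$ and let $X_1,\dots,X_n$ be random vectors in $\mathbb R^d$ satisfying Efron's orthant symmetry condition: $(X_1,\dots,X_n)$ has the same joint distribution as $(\epsilon_1X_1,\dots,\epsilon_nX_n)$, where $\epsilon_1,\dots,\epsilon_n$ are i.i.d. with $P(\epsilon_i=1)=P(\epsilon_i=-1)=\tfrac12$ and independent of $(X_1,\dots,X_n)$. Let $R=(R^2)^{1/2}$, $R^2=\cos^2\Theta$, where $\Theta\in[0,\pi/2]$ is the angle between the vector $(1,\dots,1)^T\in\mathbb R^n$ and the linear hull of the columns of the $n\times d$ matrix with rows $X_1,\dots,X_n$ ($\Theta=\pi/2$ if this hull is $\{0\}$). Let $\chi_d=(\chi_d^2)^{1/2}$, where $\chi_d^2$ has the chi-squared distribution with $d$ degrees of freedom. Let $C^2_{\uparrow,conv}$ be the class of all nonnegative even functions $f:\mathbb R\to\mathbb R$ that have a finite convex second derivative on $\mathbb R$ and are convex on $[0,\infty)$, and put $$Q_d(u)=\inf\{E f(\chi_d)/f(u):\ f\in C^2_{\uparrow,conv},\ f(u)>0\}.$$ Then for all $u\ge 0$ $$P(\sqrt n\,R\ge u)\le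 Q_d(u)<\frac{2e^3}{9}\,P(\chi_d\ge u).$$ -/

import Mathlib

open MeasureTheory ProbabilityTheory Set
open scoped ENNReal

noncomputable section

namespace Hotelling

/-! ### The generalized Hotelling statistic of a sample -/

/-- The linear hull of the columns of the `n × d` matrix whose `i`-th row is the sample point
`x i`, as a subspace of Euclidean `n`-space. -/
def columnSpan {n d : ℕ} (x : Fin n → EuclideanSpace ℝ (Fin d)) :
    Submodule ℝ (EuclideanSpace ℝ (Fin n)) :=
  Submodule.span ℝ (Set.range fun j : Fin d => WithLp.toLp 2 fun i : Fin n => x i j)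

/-- The vector `(1, …, 1)`. -/
def onesVector (n : ℕ) : EuclideanSpace ℝ (Fin n) := WithLp.toLp 2 fun _ => 1

/-- The angle between a vector and a linear subspace: the smallest angle that the vector makes
with a vector of the subspace. Mathlib sets `angle v 0 = π / 2`, and `w`, `-w` make
supplementary angles with `v`, so the value lies in `[0, π / 2]`, and it is `π / 2` for the
zero subspace. -/
def angleToSubspace {V : Type*} [NormedAddCommGroup V] [InnerProductSpace ℝ V]
    (v : V) (L : Submodule ℝ V) : ℝ :=
  ⨅ w : L, InnerProductGeometry.angle v (w : V)

/-- `R² = cos² Θ`, where `Θ` is the angle between `(1, …, 1)` and the column span. -/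
def hotellingRSq {n d : ℕ} (x : Fin n → EuclideanSpace ℝ (Fin d)) : ℝ :=
  Real.cos (angleToSubspace (onesVector n) (columnSpan x)) ^ 2

/-- `R = (R²)^{1/2}`. -/
def hotellingR {n d : ℕ} (x : Fin n → EuclideanSpace ℝ (Fin d)) : ℝ :=
  √(hotellingRSq x)

/-! ### Orthant symmetry -/

/-- The law of a random sign: `P(ε = 1) = P(ε = -1) = 1/2`. -/
def signMeasure : Measure ℝ :=
  (2⁻¹ : ℝ≥0∞) • Measure.dirac 1 + (2⁻¹ : ℝ≥0∞) • Measure.dirac (-1)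

/-- Orthant symmetry: `(X₁, …, Xₙ)` has the same joint distribution as `(ε₁ X₁, …, εₙ Xₙ)`,
where `ε₁, …, εₙ` are i.i.d. random signs independent of `(X₁, …, Xₙ)`. The signs are realized
as the coordinates of the second factor of a product space. -/
def OrthantSymmetric {Ω : Type*} [MeasurableSpace Ω] (μ : Measure Ω) {n d : ℕ}
    (X : Fin n → Ω → EuclideanSpace ℝ (Fin d)) : Prop :=
  IdentDistrib (fun (ω : Ω) (i : Fin n) => X i ω)
    (fun (p : Ω × (Fin n → ℝ)) (i : Fin n) => p.2 i • X i p.1)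
    μ (μ.prod (Measure.pi fun _ : Fin n => signMeasure))

/-! ### The chi distribution and the bound `Q_r(u)` -/

/-- The chi-squared distribution with `r` degrees of freedom: the law of the sum of the squares
of `r` independent standard normal variables. -/
def chiSquaredMeasure (r : ℕ) : Measure ℝ :=
  (Measure.pi fun _ : Fin r => gaussianReal 0 1).map fun z => ∑ i, z i ^ 2

/-- The distribution of `χ_r = (χ²_r)^{1/2}`. -/
def chiMeasure (r : ℕ) : Measure ℝ :=
  (chiSquaredMeasure r).map Real.sqrt

/-- The class `C²_conv`: even real functions on `ℝ` with a finite convex second derivative. -/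
structure C2Conv (f : ℝ → ℝ) : Prop where
  even : ∀ x, f (-x) = f x
  differentiable : Differentiable ℝ f
  differentiable_deriv : Differentiable ℝ (deriv f)
  convex_deriv_deriv : ConvexOn ℝ univ (deriv (deriv f))

/-- The class `C²_{↑,conv}`: nonnegative functions of the class `C²_conv` that are convex
on `[0, ∞)`. -/
structure C2UpConv (f : ℝ → ℝ) : Prop extends C2Conv f where
  convexOn : ConvexOn ℝ (Ici 0) f
  nonneg : ∀ x, 0 ≤ f x

/-- `Q_r(u) = inf { E f(χ_r) / f(u) : f ∈ C²_{↑,conv}, f(u) > 0 }`; the expectation of the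
nonnegative function `f` is its lower integral and may be infinite. -/
def Q (r : ℕ) (u : ℝ) : ℝ≥0∞ :=
  ⨅ (f : ℝ → ℝ) (_ : C2UpConv f) (_ : 0 < f u),
    (∫⁻ x, ENNReal.ofReal (f x) ∂(chiMeasure r)) / ENNReal.ofReal (f u)

end Hotelling

end

/-! Flipping rows by signs `ε` is the isometry `diag ε` of `n`-space, so projecting `(1, …, 1)` onto
the flipped column span has the same norm as projecting `ε` onto the original one
(`norm_projection_columnSpan_sign`). By orthant symmetry, conditionally on the sample, `√n R` is
therefore the norm of a random sign vector projected onto a fixed subspace of dimension at most `d`.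
Markov's inequality for `f` reduces the first bound to a Khinchine-type inequality: `E f ‖Pε‖ ≤ E
f(χ_d)`.

Signs are replaced by standard normals one at a time. Along a line the norm is `√((b + l t)² + C)`.
The crucial fact is that `C2Conv` is stable under `f ↦ f √(s² + C)` (`C2Conv.comp_sqrt`).
Symmetrizing in `t` then gives an even `F` with convex second derivative, for which `F t ≥ F 1 + k
(t² - 1)`; a standard normal has `E (g² - 1) = 0`, so `E F(g) ≥ F 1`.

For the second bound, the tail of `χ_d` is strictly log-concave, so it lies below `q exp (-κ (x -
u))`, where `q` is its value at `u`. Moments of a law with such a tail are explicit, and with `y = κ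
u` three test functions suffice: the constant for small `y`, the square for middling `y`, and the
symmetrized cube of `(x - t)₊` for `y ≥ 3`. The cube gives `3! e³ / 3³ = 2 e³ / 9`. -/

noncomputable section

namespace Hotelling

/-! ### Even functions with convex second derivative -/

lemma C2Conv.of_hasDerivAt {f f₁ f₂ : ℝ → ℝ} (heven : ∀ x, f (-x) = f x)
    (h₁ : ∀ x, HasDerivAt f (f₁ x) x) (h₂ : ∀ x, HasDerivAt f₁ (f₂ x) x)
    (hc : ConvexOn ℝ univ f₂) : C2Conv f := by
  have e₁ : deriv f = f₁ := funext fun x => (h₁ x).deriv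
  have e₂ : deriv f₁ = f₂ := funext fun x => (h₂ x).deriv
  refine ⟨heven, fun x => (h₁ x).differentiableAt, ?_, ?_⟩
  · rw [e₁]; exact fun x => (h₂ x).differentiableAt
  · rwa [e₁, e₂]

lemma monotoneOn_Ici_of_even_of_convexOn {w : ℝ → ℝ} (heven : ∀ x, w (-x) = w x)
    (hc : ConvexOn ℝ univ w) : MonotoneOn w (Ici 0) := by
  intro x hx y _ hxy
  have hx' : (0 : ℝ) ≤ x := hx
  have := hc.le_max_of_mem_Icc (mem_univ (-y)) (mem_univ y) (z := x) ⟨by linarith, hxy⟩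
  simpa [heven] using this

namespace C2Conv

variable {f : ℝ → ℝ} (hf : C2Conv f)
include hf

lemma hasDerivAt (x : ℝ) : HasDerivAt f (deriv f x) x := (hf.differentiable x).hasDerivAt

lemma hasDerivAt_deriv (x : ℝ) : HasDerivAt (deriv f) (deriv (deriv f) x) x :=
  (hf.differentiable_deriv x).hasDerivAt

lemma deriv_neg (x : ℝ) : deriv f (-x) = -deriv f x := by
  have h := deriv_comp_neg f x
  simp only [hf.even] at h
  linarith

lemma deriv_zero : deriv f 0 = 0 := by
  have := hf.deriv_neg 0
  simp only [neg_zero] at this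
  linarith

lemma deriv_deriv_neg (x : ℝ) : deriv (deriv f) (-x) = deriv (deriv f) x := by
  have h := deriv_comp_neg (deriv f) x
  simp only [hf.deriv_neg, deriv.fun_neg] at h
  linarith

lemma monotoneOn_deriv_deriv : MonotoneOn (deriv (deriv f)) (Ici 0) :=
  monotoneOn_Ici_of_even_of_convexOn hf.deriv_deriv_neg hf.convex_deriv_deriv

lemma continuous_deriv_deriv : Continuous (deriv (deriv f)) := by
  rw [← continuousOn_univ]
  exact hf.convex_deriv_deriv.continuousOn isOpen_univ

lemma convexOn_deriv : ConvexOn ℝ (Ici 0) (deriv f) := by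
  apply MonotoneOn.convexOn_of_deriv (convex_Ici 0) hf.differentiable_deriv.continuous.continuousOn
    hf.differentiable_deriv.differentiableOn
  exact hf.monotoneOn_deriv_deriv.mono interior_subset

/-- Since `f'` is convex on `[0, ∞)` and vanishes at `0`, the quotient `f'(t) / t` is nondecreasing.
-/
lemma deriv_mul_le {s t : ℝ} (hs : 0 ≤ s) (hst : s ≤ t) : t * deriv f s ≤ s * deriv f t := by
  rcases hst.eq_or_lt with rfl | hst
  · rfl
  have ht : 0 < t := by linarith
  have h1 : 0 ≤ 1 - s / t := by rw [sub_nonneg, div_le_one ht]; exact hst.le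
  have := hf.convexOn_deriv.2 (mem_Ici.2 le_rfl) (mem_Ici.2 ht.le) h1 (by positivity : 0 ≤ s / t)
    (by ring)
  simp only [smul_eq_mul, mul_zero, hf.deriv_zero, zero_add] at this
  rw [div_mul_cancel₀ _ ht.ne'] at this
  calc t * deriv f s ≤ t * (s / t * deriv f t) := by gcongr
    _ = s * deriv f t := by field_simp

/-- An even function with convex second derivative, as a function of the square of its argument,
lies above its tangent line at `1`. -/
lemma quadratic_minorant (t : ℝ) : f 1 + deriv f 1 / 2 * (t ^ 2 - 1) ≤ f t := by
  wlog ht : 0 ≤ t generalizing t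
  · have := this (-t) (by linarith)
    rwa [neg_sq, hf.even] at this
  -- On `t ≥ 0`, `m'` has the sign of `f'(t) / t - f'(1)`, so `m` decreases up to `1` and increases
  -- afterwards.
  set m : ℝ → ℝ := fun t => f t - deriv f 1 / 2 * t ^ 2 with hm
  have hmd : ∀ x, HasDerivAt m (deriv f x - deriv f 1 * x) x := fun x => by
    have h := (hf.hasDerivAt x).sub (((hasDerivAt_id x).pow 2).const_mul (deriv f 1 / 2))
    exact h.congr_deriv (by simp; ring)
  have hmdiff : Differentiable ℝ m := fun x => (hmd x).differentiableAt
  suffices m 1 ≤ m t by simp only [hm] at this; linarith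
  rcases le_total t 1 with h1 | h1
  · have hanti : AntitoneOn m (Icc 0 1) := by
      apply antitoneOn_of_deriv_nonpos (convex_Icc 0 1) hmdiff.continuous.continuousOn
        hmdiff.differentiableOn
      intro x hx
      rw [interior_Icc] at hx
      rw [(hmd x).deriv]
      have := hf.deriv_mul_le hx.1.le hx.2.le
      linarith
    exact hanti ⟨ht, h1⟩ ⟨zero_le_one, le_rfl⟩ h1
  · have hmono : MonotoneOn m (Ici 1) := by
      apply monotoneOn_of_deriv_nonneg (convex_Ici 1) hmdiff.continuous.continuousOn
        hmdiff.differentiableOn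
      intro x hx
      rw [interior_Ici] at hx
      rw [(hmd x).deriv]
      have := hf.deriv_mul_le zero_le_one (le_of_lt hx)
      linarith
    exact hmono (mem_Ici.2 le_rfl) h1 h1

lemma symmetrize (b l : ℝ) : C2Conv fun t => f (b + l * t) + f (b - l * t) := by
  have ha : ∀ x : ℝ, HasDerivAt (fun t => b + l * t) l x := fun x => by
    simpa using ((hasDerivAt_id x).const_mul l).const_add b
  have hs : ∀ x : ℝ, HasDerivAt (fun t => b - l * t) (-l) x := fun x => by
    simpa using ((hasDerivAt_id x).const_mul l).const_sub b
  refine C2Conv.of_hasDerivAt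
    (f₁ := fun t => deriv f (b + l * t) * l + deriv f (b - l * t) * (-l))
    (f₂ := fun t => deriv (deriv f) (b + l * t) * l * l
      + deriv (deriv f) (b - l * t) * (-l) * (-l)) ?_ ?_ ?_ ?_
  · intro x
    rw [mul_neg, sub_neg_eq_add, ← sub_eq_add_neg, add_comm]
  · exact fun x => ((hf.hasDerivAt _).comp x (ha x)).add ((hf.hasDerivAt _).comp x (hs x))
  · exact fun x => (((hf.hasDerivAt_deriv _).comp x (ha x)).mul_const l).add
      (((hf.hasDerivAt_deriv _).comp x (hs x)).mul_const (-l))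
  · have key : ∀ m : ℝ, ConvexOn ℝ univ fun t => deriv (deriv f) (b + m * t) := fun m => by
      have := hf.convex_deriv_deriv.comp_affineMap
        (AffineMap.const ℝ ℝ b + (LinearMap.toAffineMap (m • LinearMap.id : ℝ →ₗ[ℝ] ℝ)))
      simpa [Function.comp_def] using this
    have h := ((key l).add (key (-l))).smul (mul_self_nonneg l)
    refine h.congr fun x _ => ?_
    simp only [Pi.add_apply, smul_eq_mul, neg_mul, ← sub_eq_add_neg]
    ring

end C2Conv

/-! ### Stability under composition with `√(s² + C)` -/

/-- A continuous function with nondecreasing right derivative is convex. -/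
lemma convexOn_Ici_of_monotone_right_deriv {ψ D : ℝ → ℝ} (hψ : Continuous ψ)
    (hd : ∀ s, 0 ≤ s → HasDerivWithinAt ψ (D s) (Ici s) s) (hD : MonotoneOn D (Ici 0)) :
    ConvexOn ℝ (Ici 0) ψ := by
  have sub : ∀ x, 0 ≤ x → ∀ y, 0 ≤ y → ψ x + D x * (y - x) ≤ ψ y := by
    intro x hx y hy
    have lin : ∀ a b s z : ℝ, HasDerivWithinAt (fun r => a + b * (r - z)) b (Ici s) s :=
      fun a b s z => by
        simpa using ((((hasDerivAt_id s).sub_const z).const_mul b).const_add a).hasDerivWithinAt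
    rcases le_total x y with hxy | hxy
    · exact image_le_of_deriv_right_le_deriv_boundary (a := x) (b := y)
        (f := fun r => ψ x + D x * (r - x)) (f' := fun _ => D x) (B := ψ) (B' := D)
        (by fun_prop) (fun s _ => lin _ _ _ _) (by simp) hψ.continuousOn
        (fun s hs => hd s (hx.trans hs.1)) (fun s hs => hD hx (hx.trans hs.1) hs.1)
        ⟨hxy, le_rfl⟩
    · have := image_le_of_deriv_right_le_deriv_boundary (a := y) (b := x)
        (f := ψ) (f' := D) (B := fun r => ψ y + D x * (r - y)) (B' := fun _ => D x)
        hψ.continuousOn (fun s hs => hd s (hy.trans hs.1)) (by simp) (by fun_prop)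
        (fun s _ => lin _ _ _ _) (fun s hs => hD (hy.trans hs.1) hx hs.2.le)
        ⟨hxy, le_rfl⟩
      linarith
  refine ⟨convex_Ici 0, fun x hx y hy a b ha hb hab => ?_⟩
  have hx' : 0 ≤ x := hx
  have hy' : 0 ≤ y := hy
  simp only [smul_eq_mul]
  have hz : 0 ≤ a * x + b * y := by positivity
  have h1 := mul_le_mul_of_nonneg_left (sub _ hz x hx') ha
  have h2 := mul_le_mul_of_nonneg_left (sub _ hz y hy') hb
  have hb' : b = 1 - a := by linarith
  subst hb'
  nlinarith [h1, h2]

lemma convexOn_univ_of_even {ψ : ℝ → ℝ} (heven : ∀ x, ψ (-x) = ψ x)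
    (hc : ConvexOn ℝ (Ici 0) ψ) (hm : MonotoneOn ψ (Ici 0)) : ConvexOn ℝ univ ψ := by
  have habs : ∀ x, ψ |x| = ψ x := fun x => by
    rcases abs_choice x with h | h <;> rw [h]
    exact heven x
  refine ⟨convex_univ, fun x _ y _ a b ha hb hab => ?_⟩
  rw [← habs x, ← habs y, ← habs (a • x + b • y)]
  refine le_trans (hm (mem_Ici.2 (abs_nonneg _)) (mem_Ici.2 (by simp only [smul_eq_mul]; positivity))
    ?_) (hc.2 (mem_Ici.2 (abs_nonneg x)) (mem_Ici.2 (abs_nonneg y)) ha hb hab)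
  calc |a • x + b • y| ≤ |a • x| + |b • y| := abs_add_le _ _
    _ = a • |x| + b • |y| := by simp [abs_mul, abs_of_nonneg ha, abs_of_nonneg hb]

lemma _root_.ConvexOn.add_rightDeriv_mul_le {w : ℝ → ℝ} (hw : ConvexOn ℝ univ w) (x y : ℝ) :
    w x + derivWithin w (Ioi x) x * (y - x) ≤ w y := by
  have hx : x ∈ interior (univ : Set ℝ) := by simp
  rcases lt_trichotomy x y with h | rfl | h
  · have := hw.rightDeriv_le_slope_of_mem_interior hx (mem_univ y) h
    rw [slope_def_field, le_div_iff₀ (by linarith)] at this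
    linarith
  · simp
  · have := (hw.slope_le_leftDeriv_of_mem_interior (mem_univ y) hx h).trans
      (hw.leftDeriv_le_rightDeriv_of_mem_interior hx)
    rw [slope_def_field, div_le_iff₀ (by linarith)] at this
    linarith

lemma hasDerivAt_sqrt_sq_add {C : ℝ} (hC : 0 < C) (s : ℝ) :
    HasDerivAt (fun r => √(r ^ 2 + C)) (s / √(s ^ 2 + C)) s := by
  have h := (((hasDerivAt_id s).pow 2).add_const C).sqrt (by simp only [id, Pi.pow_apply]; positivity)
  refine h.congr_deriv ?_
  simp
  field_simp

namespace C2Conv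

variable {f : ℝ → ℝ} (hf : C2Conv f)
include hf

/-- The trapezoid (Hermite–Hadamard) bound: the convex `f''` lies below its chord on `[a, b]`. -/
lemma deriv_sub_deriv_le {a b : ℝ} (hab : a ≤ b) :
    deriv f b - deriv f a ≤ (b - a) * (deriv (deriv f) a + deriv (deriv f) b) / 2 := by
  rcases hab.eq_or_lt with rfl | hlt
  · simp
  set w := deriv (deriv f) with hw
  set m := (w b - w a) / (b - a) with hm
  have hB : ∀ x, HasDerivAt (fun r => deriv f a + (w a * (r - a) + m / 2 * (r - a) ^ 2))
      (w a + m * (x - a)) x := fun x => by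
    have h1 := (hasDerivAt_id x).sub_const a
    have h := ((h1.const_mul (w a)).add ((h1.pow 2).const_mul (m / 2))).const_add (deriv f a)
    exact h.congr_deriv (by simp; ring)
  have := image_le_of_deriv_right_le_deriv_boundary (a := a) (b := b) (f := deriv f) (f' := w)
    (B' := fun x => w a + m * (x - a))
    hf.differentiable_deriv.continuous.continuousOn
    (fun x _ => (hf.hasDerivAt_deriv x).hasDerivWithinAt) (by simp)
    (fun x _ => (hB x).continuousAt.continuousWithinAt) (fun x _ => (hB x).hasDerivWithinAt)
    (fun x hx => ?_) (right_mem_Icc.2 hab)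
  · have e : m * (b - a) = w b - w a := div_mul_cancel₀ _ (by linarith)
    nlinarith [this]
  · rcases hx.1.eq_or_lt with rfl | hax
    · simp
    have := hf.convex_deriv_deriv.secant_mono (mem_univ a) (mem_univ x) (mem_univ b) hax.ne'
      hlt.ne' hx.2.le
    rw [div_le_iff₀ (by linarith)] at this
    linarith

/-- The tangent to the convex `f''` at `r` lies below it; integrate over `[0, r]` and use `f'(0) =
0`. -/
lemma mul_deriv_deriv_sub_deriv_le (r : ℝ) (hr : 0 ≤ r) :
    r * deriv (deriv f) r - deriv f r ≤
      derivWithin (deriv (deriv f)) (Ioi r) r * r ^ 2 / 2 := by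
  set w := deriv (deriv f) with hw
  set g := derivWithin w (Ioi r) r with hg
  have hB : ∀ x, HasDerivAt (fun y => w r * y + g / 2 * (y - r) ^ 2 - g / 2 * r ^ 2)
      (w r + g * (x - r)) x := fun x => by
    have h1 := (hasDerivAt_id x).sub_const r
    have h := (((hasDerivAt_id x).const_mul (w r)).add
      ((h1.pow 2).const_mul (g / 2))).sub_const (g / 2 * r ^ 2)
    exact h.congr_deriv (by simp; ring)
  have := image_le_of_deriv_right_le_deriv_boundary (a := 0) (b := r) (B := deriv f) (B' := w)
    (f' := fun x => w r + g * (x - r))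
    (fun x _ => (hB x).continuousAt.continuousWithinAt) (fun x _ => (hB x).hasDerivWithinAt)
    (by simp [hf.deriv_zero])
    hf.differentiable_deriv.continuous.continuousOn
    (fun x _ => (hf.hasDerivAt_deriv x).hasDerivWithinAt)
    (fun x _ => hf.convex_deriv_deriv.add_rightDeriv_mul_le r x) (right_mem_Icc.2 hr)
  nlinarith [this]

lemma rightDeriv_nonneg {r : ℝ} (hr : 0 ≤ r) :
    0 ≤ derivWithin (deriv (deriv f)) (Ioi r) r := by
  exact (hf.monotoneOn_deriv_deriv.mono fun x hx => hr.trans (le_of_lt hx)).derivWithin_nonneg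

lemma hasDerivAt_comp_sqrt {C : ℝ} (hC : 0 < C) (s : ℝ) :
    HasDerivAt (fun r => f √(r ^ 2 + C)) (deriv f √(s ^ 2 + C) * (s / √(s ^ 2 + C))) s :=
  (hf.hasDerivAt _).comp s (hasDerivAt_sqrt_sq_add hC s)

/-- The second derivative of `s ↦ f √(s² + C)`. -/
lemma hasDerivAt_deriv_comp_sqrt {C : ℝ} (hC : 0 < C) (s : ℝ) :
    HasDerivAt (fun r => deriv f √(r ^ 2 + C) * (r / √(r ^ 2 + C)))
      (deriv (deriv f) √(s ^ 2 + C) * (s ^ 2 / √(s ^ 2 + C) ^ 2)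
        + deriv f √(s ^ 2 + C) * (C / √(s ^ 2 + C) ^ 3)) s := by
  have hρ := hasDerivAt_sqrt_sq_add hC s
  have hpos : 0 < √(s ^ 2 + C) := Real.sqrt_pos.2 (by positivity)
  have hsq : √(s ^ 2 + C) ^ 2 = s ^ 2 + C := Real.sq_sqrt (by positivity)
  have h := ((hf.hasDerivAt_deriv _).comp s hρ).mul ((hasDerivAt_id s).div hρ hpos.ne')
  refine h.congr_deriv ?_
  simp only [id, Function.comp_apply, Pi.div_apply]
  have hC' : C = √(s ^ 2 + C) ^ 2 - s ^ 2 := by linarith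
  generalize √(s ^ 2 + C) = ρ at *
  subst hC'
  field_simp

/-- The right derivative of the second derivative of `s ↦ f √(s² + C)`. -/
lemma hasDerivWithinAt_deriv_deriv_comp_sqrt {C : ℝ} (hC : 0 < C) {s : ℝ} (hs : 0 ≤ s) :
    HasDerivWithinAt (fun r => deriv (deriv f) √(r ^ 2 + C) * (r ^ 2 / √(r ^ 2 + C) ^ 2)
        + deriv f √(r ^ 2 + C) * (C / √(r ^ 2 + C) ^ 3))
      (derivWithin (deriv (deriv f)) (Ioi √(s ^ 2 + C)) √(s ^ 2 + C) * (s ^ 3 / √(s ^ 2 + C) ^ 3)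
        + 3 * C * (√(s ^ 2 + C) * deriv (deriv f) √(s ^ 2 + C) - deriv f √(s ^ 2 + C))
          * (s / √(s ^ 2 + C) ^ 5)) (Ici s) s := by
  have hρ := hasDerivAt_sqrt_sq_add hC s
  have hpos : 0 < √(s ^ 2 + C) := Real.sqrt_pos.2 (by positivity)
  have hsq : √(s ^ 2 + C) ^ 2 = s ^ 2 + C := Real.sq_sqrt (by positivity)
  have hw : HasDerivWithinAt (deriv (deriv f))
      (derivWithin (deriv (deriv f)) (Ioi √(s ^ 2 + C)) √(s ^ 2 + C)) (Ici √(s ^ 2 + C))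
      √(s ^ 2 + C) :=
    (hf.convex_deriv_deriv.hasDerivWithinAt_rightDeriv_of_mem_interior (by simp)).Ici_of_Ioi
  have hwc := hw.comp s hρ.hasDerivWithinAt (s := Ici s) (fun r hr => by
    have : s ≤ r := hr
    exact Real.sqrt_le_sqrt (by gcongr))
  have h1 := (((hasDerivAt_id s).pow 2).div (hρ.pow 2) (pow_pos hpos 2).ne').hasDerivWithinAt
    (s := Ici s)
  have h2 := (((hf.hasDerivAt_deriv _).comp s hρ).mul ((hasDerivAt_const s C).div (hρ.pow 3)
    (pow_pos hpos 3).ne')).hasDerivWithinAt (s := Ici s)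
  refine ((hwc.mul h1).add h2).congr_deriv ?_
  simp only [id, Function.comp_apply, Pi.pow_apply, Pi.div_apply]
  have hC' : C = √(s ^ 2 + C) ^ 2 - s ^ 2 := by linarith
  generalize √(s ^ 2 + C) = ρ at *
  subst hC'
  field_simp
  push_cast
  ring

/-- This is the monotonicity of the third (right) derivative of `f √(s² + C)`. As `f''` has only a
one-sided derivative, nothing can be differentiated again. Instead the slope of `f''` is frozen at
its value `g` at the left endpoint, which gives a smooth lower bound `E` whose growth is checked
directly. -/
lemma monotoneOn_right_deriv_comp_sqrt {C : ℝ} (hC : 0 < C) :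
    MonotoneOn (fun s =>
      derivWithin (deriv (deriv f)) (Ioi √(s ^ 2 + C)) √(s ^ 2 + C) * (s ^ 3 / √(s ^ 2 + C) ^ 3)
        + 3 * C * (√(s ^ 2 + C) * deriv (deriv f) √(s ^ 2 + C) - deriv f √(s ^ 2 + C))
          * (s / √(s ^ 2 + C) ^ 5)) (Ici 0) := by
  intro s hs t ht hst
  have hs0 : 0 ≤ s := hs
  have ht0 : 0 ≤ t := ht
  set g := derivWithin (deriv (deriv f)) (Ioi √(s ^ 2 + C)) √(s ^ 2 + C) with hg
  set K := √(s ^ 2 + C) * deriv (deriv f) √(s ^ 2 + C) - deriv f √(s ^ 2 + C) with hK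
  have hρ : ∀ r, 0 < √(r ^ 2 + C) := fun r => Real.sqrt_pos.2 (by positivity)
  have hsq : ∀ r, √(r ^ 2 + C) ^ 2 = r ^ 2 + C := fun r => Real.sq_sqrt (by positivity)
  have hle : √(s ^ 2 + C) ≤ √(t ^ 2 + C) := Real.sqrt_le_sqrt (by gcongr)
  -- With the slope frozen at `g`, the quantity `ρ f''(ρ) - f'(ρ)` grows at rate `g ρ`, so `g ρ² /
  -- 2` minus it stays equal to `H`.
  set H := g * √(s ^ 2 + C) ^ 2 / 2 - K with hH
  have hg0 : 0 ≤ g := hf.rightDeriv_nonneg (hρ s).le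
  have hH0 : 0 ≤ H := sub_nonneg.2 (hf.mul_deriv_deriv_sub_deriv_le _ (hρ s).le)
  have hK0 : 0 ≤ K := by
    have := hf.deriv_sub_deriv_le (hρ s).le
    have h0 := hf.monotoneOn_deriv_deriv (mem_Ici.2 le_rfl) (mem_Ici.2 (hρ s).le) (hρ s).le
    rw [hf.deriv_zero] at this
    have := mul_le_mul_of_nonneg_left h0 (hρ s).le
    rw [hK]
    linarith
  -- the right derivative dominates `E`, with equality at `s`
  let E : ℝ → ℝ := fun r => g * (r ^ 3 / √(r ^ 2 + C) ^ 3)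
    + 3 * C * (g * √(r ^ 2 + C) ^ 2 / 2 - H) * (r / √(r ^ 2 + C) ^ 5)
  have hE' : ∀ r, HasDerivAt E (3 * C / √(r ^ 2 + C) ^ 7 *
      (g / 2 * C * √(r ^ 2 + C) ^ 2 - H * (C - 4 * r ^ 2))) r := fun r => by
    have hd := hasDerivAt_sqrt_sq_add hC r
    have h := (((((hasDerivAt_id r).pow 3).div (hd.pow 3) (pow_pos (hρ r) 3).ne').const_mul g).add
      ((((((hd.pow 2).const_mul g).div_const 2).sub_const H).const_mul (3 * C)).mul
        ((hasDerivAt_id r).div (hd.pow 5) (pow_pos (hρ r) 5).ne')))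
    refine h.congr_deriv ?_
    simp only [id, Pi.pow_apply, Pi.div_apply]
    have hC' : C = √(r ^ 2 + C) ^ 2 - r ^ 2 := by linarith [hsq r]
    have hp := hρ r
    clear h hd hH0 hK0 hH
    generalize √(r ^ 2 + C) = ρ at *
    subst hC'
    field_simp
    push_cast
    ring
  have hEmono : MonotoneOn E (Ici s) := by
    apply monotoneOn_of_deriv_nonneg (convex_Ici s)
      (fun r _ => (hE' r).continuousAt.continuousWithinAt)
      (fun r _ => (hE' r).differentiableAt.differentiableWithinAt)
    intro r hr
    rw [interior_Ici] at hr
    have hsr : s ≤ r := le_of_lt hr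
    rw [(hE' r).deriv]
    have hp := hρ r
    apply mul_nonneg (by positivity)
    have h1 : √(s ^ 2 + C) ^ 2 ≤ √(r ^ 2 + C) ^ 2 := by
      rw [hsq, hsq]; gcongr
    have h2 : H ≤ g / 2 * √(r ^ 2 + C) ^ 2 := by nlinarith
    have h3 := mul_le_mul_of_nonneg_left h2 hC.le
    have h4 : 0 ≤ H * (4 * r ^ 2) := by positivity
    linarith
  have hEs : E s = g * (s ^ 3 / √(s ^ 2 + C) ^ 3) + 3 * C * K * (s / √(s ^ 2 + C) ^ 5) := by
    simp only [E, hH]; ring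
  have hEst := hEmono (mem_Ici.2 le_rfl) hst hst
  rw [hEs] at hEst
  refine hEst.trans ?_
  have hgt : g ≤ derivWithin (deriv (deriv f)) (Ioi √(t ^ 2 + C)) √(t ^ 2 + C) :=
    hf.convex_deriv_deriv.monotoneOn_rightDeriv (by simp) (by simp) hle
  have hKt : g * √(t ^ 2 + C) ^ 2 / 2 - H ≤
      √(t ^ 2 + C) * deriv (deriv f) √(t ^ 2 + C) - deriv f √(t ^ 2 + C) := by
    have h1 := hf.deriv_sub_deriv_le hle
    have h2 := hf.convex_deriv_deriv.add_rightDeriv_mul_le √(s ^ 2 + C) √(t ^ 2 + C)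
    rw [← hg] at h2
    have h3 := mul_le_mul_of_nonneg_left h2 (add_nonneg (hρ s).le (hρ t).le)
    rw [hH, hK]
    linarith
  have hpt := hρ t
  simp only [E]
  gcongr

/-- The class `C2Conv` is stable under `f ↦ (s ↦ f √(s² + C))`. -/
lemma comp_sqrt {C : ℝ} (hC : 0 ≤ C) : C2Conv fun s => f √(s ^ 2 + C) := by
  rcases hC.eq_or_lt with rfl | hC
  · convert hf using 2 with s
    rw [add_zero, Real.sqrt_sq_eq_abs]
    rcases abs_choice s with h | h <;> rw [h]
    exact hf.even s
  have hcw := hf.continuous_deriv_deriv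
  have hcd := hf.differentiable_deriv.continuous
  have hρ : ∀ r, 0 < √(r ^ 2 + C) := fun r => Real.sqrt_pos.2 (by positivity)
  have hcont : Continuous fun r => deriv (deriv f) √(r ^ 2 + C) * (r ^ 2 / √(r ^ 2 + C) ^ 2)
        + deriv f √(r ^ 2 + C) * (C / √(r ^ 2 + C) ^ 3) := by
    fun_prop (disch := exact fun r => (pow_pos (hρ r) _).ne')
  have hD := hf.monotoneOn_right_deriv_comp_sqrt hC
  have hd := fun s hs => hf.hasDerivWithinAt_deriv_deriv_comp_sqrt hC (s := s) hs
  refine of_hasDerivAt (fun s => by rw [neg_sq]) (hf.hasDerivAt_comp_sqrt hC)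
    (hf.hasDerivAt_deriv_comp_sqrt hC) (convexOn_univ_of_even (fun s => by simp only [neg_sq])
      (convexOn_Ici_of_monotone_right_deriv hcont hd hD) ?_)
  intro s hs t ht hst
  refine image_le_of_deriv_right_le_deriv_boundary (a := s) (b := t) (f' := fun _ => 0)
    continuousOn_const (fun x _ => hasDerivWithinAt_const _ _ _) le_rfl hcont.continuousOn
    (fun x hx => hd x (le_trans hs hx.1)) (fun x hx => ?_) ⟨hst, le_rfl⟩
  -- The right derivative vanishes at `0`, so its monotonicity makes it nonnegative.
  have := hD (mem_Ici.2 le_rfl) (mem_Ici.2 (le_trans hs hx.1)) (le_trans hs hx.1)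
  simpa using this

end C2Conv

/-- Evenness forces `f'(0) = 0`, and convexity keeps the slope nonnegative from there on. -/
lemma C2UpConv.monotoneOn {f : ℝ → ℝ} (hf : C2UpConv f) : MonotoneOn f (Ici 0) := by
  apply monotoneOn_of_deriv_nonneg (convex_Ici 0) hf.differentiable.continuous.continuousOn
    hf.differentiable.differentiableOn
  intro x hx
  rw [interior_Ici] at hx
  have := hf.convexOn.le_slope_of_hasDerivWithinAt_Ioi (mem_Ici.2 le_rfl) (mem_Ici.2 (le_of_lt hx))
    hx (hf.toC2Conv.hasDerivAt 0).hasDerivWithinAt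
  rw [hf.deriv_zero] at this
  exact this.trans (hf.convexOn.slope_le_of_hasDerivAt (mem_Ici.2 le_rfl) (mem_Ici.2 (le_of_lt hx))
    hx (hf.toC2Conv.hasDerivAt x))

/-! ### From signs to Gaussians -/

open scoped RealInnerProductSpace

instance : IsProbabilityMeasure signMeasure := ⟨by
  simp [signMeasure, ENNReal.inv_two_add_inv_two]⟩

lemma lintegral_signMeasure (h : ℝ → ℝ≥0∞) :
    ∫⁻ x, h x ∂signMeasure = 2⁻¹ * h 1 + 2⁻¹ * h (-1) := by
  simp [signMeasure]

lemma integrable_sq_gaussianReal : Integrable (fun x : ℝ => x ^ 2) (gaussianReal 0 1) :=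
  (memLp_id_gaussianReal 2).integrable_sq

lemma integral_sq_gaussianReal : ∫ x, x ^ 2 ∂gaussianReal 0 1 = 1 := by
  have h := variance_eq_sub (memLp_id_gaussianReal (μ := 0) (v := 1) 2)
  rw [variance_id_gaussianReal] at h
  simpa using h.symm

/-- The minorant `G` may take negative values and `F` may have infinite expectation, so neither a
pure Bochner nor a pure lower-integral comparison applies. -/
lemma ofReal_integral_le_lintegral_ofReal {α : Type*} [MeasurableSpace α] {μ : Measure α}
    {F G : α → ℝ} (hG : Integrable G μ) (hF : AEStronglyMeasurable F μ) (hF0 : ∀ x, 0 ≤ F x)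
    (hGF : ∀ x, G x ≤ F x) : ENNReal.ofReal (∫ x, G x ∂μ) ≤ ∫⁻ x, ENNReal.ofReal (F x) ∂μ := by
  by_cases hfin : ∫⁻ x, ENNReal.ofReal (F x) ∂μ = ∞
  · simp [hfin]
  have hFi : Integrable F μ :=
    (lintegral_ofReal_ne_top_iff_integrable hF (.of_forall hF0)).1 hfin
  rw [← ofReal_integral_eq_lintegral_ofReal hFi (.of_forall hF0)]
  exact ENNReal.ofReal_le_ofReal (integral_mono hG hFi hGF)

lemma gaussianReal_map_neg_eq : (gaussianReal 0 1).map (fun x => -x) = gaussianReal 0 1 := by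
  simpa using gaussianReal_map_neg (μ := 0) (v := 1)

section InnerProduct

variable {E : Type*} [NormedAddCommGroup E] [InnerProductSpace ℝ E]

lemma exists_norm_add_smul_eq (z y : E) :
    ∃ b l C : ℝ, 0 ≤ C ∧ ∀ t : ℝ, ‖z + t • y‖ = √((b + l * t) ^ 2 + C) := by
  have hbl : ⟪z, y⟫ / ‖y‖ * ‖y‖ = ⟪z, y⟫ := by
    by_cases hy : y = 0
    · simp [hy]
    · exact div_mul_cancel₀ _ (norm_ne_zero_iff.2 hy)
  -- `b` is the component of `z` along `y`, and `C` the squared distance from `z` to the line of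
  -- `y`. For `y = 0` division by zero gives `b = 0`, which is still correct.
  refine ⟨⟪z, y⟫ / ‖y‖, ‖y‖, ‖z‖ ^ 2 - (⟪z, y⟫ / ‖y‖) ^ 2, ?_, fun t => ?_⟩
  · rw [sub_nonneg, sq_le_sq, abs_div, abs_norm, abs_norm]
    exact div_le_of_le_mul₀ (norm_nonneg _) (norm_nonneg _) (abs_real_inner_le_norm z y)
  · rw [← Real.sqrt_sq (norm_nonneg (z + t • y)), norm_add_sq_real, norm_smul, inner_smul_right,
      Real.norm_eq_abs, mul_pow, sq_abs]
    congr 1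
    linear_combination (-2 * t) * hbl

/-- Replacing a random sign by a standard normal variable increases the expectation. -/
lemma C2UpConv.sign_le_gaussian {f : ℝ → ℝ} (hf : C2UpConv f) (z y : E) :
    ∫⁻ t, ENNReal.ofReal (f ‖z + t • y‖) ∂signMeasure ≤
      ∫⁻ t, ENNReal.ofReal (f ‖z + t • y‖) ∂gaussianReal 0 1 := by
  obtain ⟨b, l, C, hC, hn⟩ := exists_norm_add_smul_eq z y
  have hF := (hf.toC2Conv.comp_sqrt hC).symmetrize b l
  have hfc := hf.differentiable.continuous
  simp only [hn]
  rw [lintegral_signMeasure, ← mul_add]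
  simp only [mul_one, mul_neg]
  set φ : ℝ → ℝ := fun s => f √(s ^ 2 + C) with hφ
  have hφc : Continuous φ := by fun_prop
  have hφ0 : ∀ s, 0 ≤ φ s := fun s => hf.nonneg _
  set k := deriv (fun t => φ (b + l * t) + φ (b - l * t)) 1 / 2
  have hint : Integrable (fun t : ℝ => φ (b + l * 1) + φ (b - l * 1) + k * (t ^ 2 - 1))
      (gaussianReal 0 1) :=
    (integrable_const _).add ((integrable_sq_gaussianReal.sub (integrable_const _)).const_mul k)
  have hval : ∫ t, (φ (b + l * 1) + φ (b - l * 1) + k * (t ^ 2 - 1)) ∂gaussianReal 0 1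
      = φ (b + l * 1) + φ (b - l * 1) := by
    have hk : Integrable (fun t : ℝ => k * (t ^ 2 - 1)) (gaussianReal 0 1) :=
      (integrable_sq_gaussianReal.sub (integrable_const _)).const_mul k
    rw [integral_add (integrable_const _) hk, integral_const_mul,
      integral_sub integrable_sq_gaussianReal (integrable_const _), integral_sq_gaussianReal]
    simp
  have hle := ofReal_integral_le_lintegral_ofReal hint
    (F := fun t => φ (b + l * t) + φ (b - l * t))
    (by fun_prop) (fun t => add_nonneg (hφ0 _) (hφ0 _)) (fun t => hF.quadratic_minorant t)
  rw [hval] at hle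
  -- The normal law is symmetric, so the two halves of the symmetrization have equal integrals.
  have hsymm : ∫⁻ t, ENNReal.ofReal (φ (b - l * t)) ∂gaussianReal 0 1
      = ∫⁻ t, ENNReal.ofReal (φ (b + l * t)) ∂gaussianReal 0 1 := by
    conv_rhs => rw [← gaussianReal_map_neg_eq]
    rw [lintegral_map (by fun_prop) (by fun_prop)]
    simp only [mul_neg, sub_eq_add_neg]
  simp only [ENNReal.ofReal_add (hφ0 _) (hφ0 _)] at hle
  rw [lintegral_add_left (by fun_prop), hsymm, ← two_mul] at hle
  simp only [mul_one, sub_eq_add_neg] at hle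
  calc _ ≤ 2⁻¹ * (2 * ∫⁻ t, ENNReal.ofReal (φ (b + l * t)) ∂gaussianReal 0 1) := by
        gcongr
    _ = _ := by
        rw [← mul_assoc, ENNReal.inv_mul_cancel (by simp) (by simp), one_mul]

lemma lintegral_pi_succ {n : ℕ} (ν : Measure ℝ) [SigmaFinite ν] {h : (Fin (n + 1) → ℝ) → ℝ≥0∞}
    (hh : Measurable h) :
    ∫⁻ x, h x ∂(Measure.pi fun _ => ν) =
      ∫⁻ a, ∫⁻ b, h (Fin.cons a b) ∂(Measure.pi fun _ => ν) ∂ν := by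
  have hmp := (measurePreserving_piFinSuccAbove (fun _ : Fin (n + 1) => ν) 0).symm
  rw [← hmp.lintegral_comp hh, lintegral_prod]
  · simp [MeasurableEquiv.piFinSuccAbove_symm_apply, Fin.consEquiv]
  · exact (hh.comp (MeasurableEquiv.measurable _)).aemeasurable

/-- Comparison of Rademacher and Gaussian sums of vectors. -/
lemma C2UpConv.rademacher_sum_le_gaussian_sum {f : ℝ → ℝ} (hf : C2UpConv f) {n : ℕ}
    (y : Fin n → E) (z : E) :
    ∫⁻ ε, ENNReal.ofReal (f ‖z + ∑ i, ε i • y i‖) ∂(Measure.pi fun _ => signMeasure) ≤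
      ∫⁻ g, ENNReal.ofReal (f ‖z + ∑ i, g i • y i‖)
        ∂(Measure.pi fun _ => gaussianReal 0 1) := by
  have hfc := hf.differentiable.continuous
  induction n generalizing z with
  | zero => simp
  | succ n ih =>
    have hm : Measurable fun ε : Fin (n + 1) → ℝ => ENNReal.ofReal (f ‖z + ∑ i, ε i • y i‖) :=
      Continuous.measurable (ENNReal.continuous_ofReal.comp (by fun_prop))
    have hc : Continuous fun p : ℝ × (Fin n → ℝ) =>
        ENNReal.ofReal (f ‖z + (p.1 • y 0 + ∑ i, p.2 i • y i.succ)‖) :=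
      ENNReal.continuous_ofReal.comp (by fun_prop)
    have swap : ∀ (ν : Measure ℝ) [SFinite ν],
        ∫⁻ a, ∫⁻ b, ENNReal.ofReal (f ‖z + (a • y 0 + ∑ i : Fin n, b i • y i.succ)‖)
          ∂(Measure.pi fun _ : Fin n => gaussianReal 0 1) ∂ν =
        ∫⁻ b, ∫⁻ a, ENNReal.ofReal (f ‖z + (a • y 0 + ∑ i : Fin n, b i • y i.succ)‖)
          ∂ν ∂(Measure.pi fun _ : Fin n => gaussianReal 0 1) :=
      fun ν _ => lintegral_lintegral_swap hc.aemeasurable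
    rw [lintegral_pi_succ _ hm, lintegral_pi_succ _ hm]
    simp only [Fin.sum_univ_succ, Fin.cons_zero, Fin.cons_succ]
    calc _ ≤ ∫⁻ a, ∫⁻ b, ENNReal.ofReal (f ‖z + (a • y 0 + ∑ i : Fin n, b i • y i.succ)‖)
          ∂(Measure.pi fun _ : Fin n => gaussianReal 0 1) ∂signMeasure := by
          refine lintegral_mono fun a => ?_
          simpa only [add_assoc] using ih (fun i => y i.succ) (z + a • y 0)
      _ = ∫⁻ b, ∫⁻ a, ENNReal.ofReal (f ‖z + (a • y 0 + ∑ i : Fin n, b i • y i.succ)‖)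
          ∂signMeasure ∂(Measure.pi fun _ : Fin n => gaussianReal 0 1) :=
          swap _
      _ ≤ ∫⁻ b, ∫⁻ a, ENNReal.ofReal (f ‖z + (a • y 0 + ∑ i : Fin n, b i • y i.succ)‖)
          ∂gaussianReal 0 1 ∂(Measure.pi fun _ : Fin n => gaussianReal 0 1) := by
          refine lintegral_mono fun b => ?_
          have := hf.sign_le_gaussian (z + ∑ i : Fin n, b i • y i.succ) (y 0)
          simpa only [add_assoc, add_comm (∑ i : Fin n, b i • y i.succ)] using this
      _ = ∫⁻ a, ∫⁻ b, ENNReal.ofReal (f ‖z + (a • y 0 + ∑ i : Fin n, b i • y i.succ)‖)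
          ∂(Measure.pi fun _ : Fin n => gaussianReal 0 1) ∂gaussianReal 0 1 :=
          (swap _).symm

/-- Characteristic functions: `⟪ι* x, t⟫ = ⟪x, ι t⟫` and `‖ι t‖ = ‖t‖`. It serves twice: for the
inclusion of a subspace, whose adjoint is the projection, and for an embedding of that subspace into
`d`-space. -/
lemma stdGaussian_map_adjoint {F : Type*} [NormedAddCommGroup F] [InnerProductSpace ℝ F]
    [FiniteDimensional ℝ E] [MeasurableSpace E] [BorelSpace E]
    [FiniteDimensional ℝ F] [MeasurableSpace F] [BorelSpace F] (ι : F →ₗᵢ[ℝ] E) :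
    (stdGaussian E).map (ContinuousLinearMap.adjoint ι.toContinuousLinearMap) = stdGaussian F := by
  have : IsFiniteMeasure
      ((stdGaussian E).map (ContinuousLinearMap.adjoint ι.toContinuousLinearMap)) :=
    Measure.isFiniteMeasure_map _ _
  refine Measure.ext_of_charFun (funext fun t => ?_)
  have h := charFun_stdGaussian (E := E) (ι t)
  rw [ι.norm_map, charFun_apply] at h
  rw [charFun_stdGaussian, ← h, charFun_apply, integral_map (by fun_prop) (by fun_prop)]
  simp only [ContinuousLinearMap.adjoint_inner_left, LinearIsometry.coe_toContinuousLinearMap]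

end InnerProduct

lemma chiMeasure_eq_map_norm (d : ℕ) :
    chiMeasure d = (stdGaussian (EuclideanSpace ℝ (Fin d))).map (fun x => ‖x‖) := by
  rw [← map_pi_eq_stdGaussian, chiMeasure, chiSquaredMeasure,
    Measure.map_map (by fun_prop) (by fun_prop), Measure.map_map (by fun_prop) (by fun_prop)]
  congr 1
  ext z
  simp [EuclideanSpace.norm_eq]

instance (d : ℕ) : IsProbabilityMeasure (chiMeasure d) := by
  rw [chiMeasure_eq_map_norm]
  exact Measure.isProbabilityMeasure_map (by fun_prop)

/-- The generalized Khinchine inequality for the projection of a random sign vector. -/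
lemma C2UpConv.lintegral_projection_sign_le {f : ℝ → ℝ} (hf : C2UpConv f) {n d : ℕ}
    (L : Submodule ℝ (EuclideanSpace ℝ (Fin n))) (hL : Module.finrank ℝ L ≤ d) :
    ∫⁻ ε, ENNReal.ofReal (f ‖L.orthogonalProjectionOnto (WithLp.toLp 2 ε)‖)
        ∂(Measure.pi fun _ => signMeasure) ≤
      ∫⁻ x, ENNReal.ofReal (f x) ∂chiMeasure d := by
  have hfc := hf.differentiable.continuous
  set P := L.orthogonalProjectionOnto with hP
  have hsum : ∀ ε : Fin n → ℝ, P (WithLp.toLp 2 ε) =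
      0 + ∑ i, ε i • P (EuclideanSpace.single i 1) := fun ε => by
    rw [zero_add]
    have : ∑ i, ε i • P (EuclideanSpace.single i 1) = P (∑ i, ε i • EuclideanSpace.single i 1) := by
      rw [map_sum]
      exact Finset.sum_congr rfl fun i _ => (P.map_smul _ _).symm
    rw [this]
    congr 1
    ext j
    simp [Finset.sum_apply, Pi.single_apply]
  have hadj : ContinuousLinearMap.adjoint L.subtypeₗᵢ.toContinuousLinearMap = P := by
    rw [hP, ← Submodule.adjoint_subtypeL]
    rfl
  obtain ⟨ι⟩ : Nonempty (L →ₗᵢ[ℝ] EuclideanSpace ℝ (Fin d)) := by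
    let v := stdOrthonormalBasis ℝ L
    let e := EuclideanSpace.basisFun (Fin d) ℝ
    refine ⟨(v.toBasis.constr ℝ (e ∘ Fin.castLE hL)).isometryOfOrthonormal (v := v.toBasis)
      (by simp) ?_⟩
    have h : ⇑(v.toBasis.constr ℝ (e ∘ Fin.castLE hL)) ∘ v.toBasis = e ∘ Fin.castLE hL :=
      funext fun i => Module.Basis.constr_basis _ _ _ _
    rw [h]
    exact e.orthonormal.comp _ (Fin.castLE_injective hL)
  calc _ ≤ ∫⁻ g, ENNReal.ofReal (f ‖P (WithLp.toLp 2 g)‖)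
        ∂(Measure.pi fun _ => gaussianReal 0 1) := by
        have h := hf.rademacher_sum_le_gaussian_sum
          (fun i => P (EuclideanSpace.single i 1)) 0
        simpa only [← hsum] using h
    _ = ∫⁻ x, ENNReal.ofReal (f ‖x‖) ∂(stdGaussian L) := by
        rw [← stdGaussian_map_adjoint L.subtypeₗᵢ, hadj, lintegral_map (by fun_prop) (by fun_prop),
          ← map_pi_eq_stdGaussian, lintegral_map (by fun_prop) (by fun_prop)]
    -- The adjoint of an isometry is a contraction, so a Gaussian norm in dimension at most `d` is
    -- dominated by `χ_d`, and `f` is monotone.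
    _ ≤ ∫⁻ x, ENNReal.ofReal (f ‖x‖) ∂(stdGaussian (EuclideanSpace ℝ (Fin d))) := by
        rw [← stdGaussian_map_adjoint ι, lintegral_map (by fun_prop) (by fun_prop)]
        refine lintegral_mono fun x => ENNReal.ofReal_le_ofReal
          (hf.monotoneOn (norm_nonneg _) (norm_nonneg _) ?_)
        refine (ContinuousLinearMap.le_opNorm _ x).trans (mul_le_of_le_one_left (norm_nonneg _) ?_)
        rw [LinearIsometryEquiv.norm_map]
        exact ι.norm_toContinuousLinearMap_le
    _ = _ := by
        rw [chiMeasure_eq_map_norm, lintegral_map (by fun_prop) (by fun_prop)]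

/-! ### The statistic as the norm of a projection -/

lemma angle_orthogonalProjection_le {V : Type*} [NormedAddCommGroup V] [InnerProductSpace ℝ V]
    (v : V) (L : Submodule ℝ V) [L.HasOrthogonalProjection] (w : L) :
    InnerProductGeometry.angle v (L.orthogonalProjectionOnto v) ≤
      InnerProductGeometry.angle v w := by
  have hin : ∀ w : L, ⟪v, (w : V)⟫ = ⟪L.orthogonalProjectionOnto v, w⟫ := fun w =>
    (Submodule.inner_orthogonalProjectionOnto_eq_of_mem_right w v).symm
  refine Real.antitone_arccos ?_
  rw [hin, hin, real_inner_self_eq_norm_sq]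
  set p := L.orthogonalProjectionOnto v
  have e1 : ‖p‖ ^ 2 / (‖v‖ * ‖(p : V)‖) = ‖p‖ / ‖v‖ := by
    rw [Submodule.coe_norm]
    by_cases hp : ‖(p : V)‖ = 0
    · simp [hp]
    · rw [sq, mul_div_mul_right _ _ hp]
  rw [e1, mul_comm ‖v‖, ← div_div]
  gcongr
  exact div_le_of_le_mul₀ (norm_nonneg _) (norm_nonneg _) (real_inner_le_norm _ _)

lemma cos_angleToSubspace {V : Type*} [NormedAddCommGroup V] [InnerProductSpace ℝ V]
    (v : V) (L : Submodule ℝ V) [L.HasOrthogonalProjection] :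
    Real.cos (angleToSubspace v L) = ‖L.orthogonalProjectionOnto v‖ / ‖v‖ := by
  have hbdd : BddBelow (range fun w : L => InnerProductGeometry.angle v (w : V)) :=
    ⟨0, by rintro _ ⟨w, rfl⟩; exact InnerProductGeometry.angle_nonneg _ _⟩
  have : angleToSubspace v L = InnerProductGeometry.angle v (L.orthogonalProjectionOnto v) :=
    le_antisymm (ciInf_le hbdd _) (le_ciInf (angle_orthogonalProjection_le v L))
  rw [this, InnerProductGeometry.cos_angle,
    ← Submodule.inner_orthogonalProjectionOnto_eq_of_mem_right, real_inner_self_eq_norm_sq,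
    Submodule.coe_norm]
  by_cases hp : ‖((L.orthogonalProjectionOnto v : L) : V)‖ = 0
  · rw [hp]; simp
  · rw [sq, mul_div_mul_right _ _ hp]

lemma norm_onesVector (n : ℕ) : ‖onesVector n‖ = √n := by
  simp [onesVector, EuclideanSpace.norm_eq]

lemma sqrt_mul_hotellingR {n d : ℕ} (hn : 1 ≤ n) (x : Fin n → EuclideanSpace ℝ (Fin d)) :
    √(n : ℝ) * hotellingR x = ‖(columnSpan x).orthogonalProjectionOnto (onesVector n)‖ := by
  have hn' : (0 : ℝ) < √n := Real.sqrt_pos.2 (by exact_mod_cast hn)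
  rw [hotellingR, hotellingRSq, cos_angleToSubspace, norm_onesVector,
    Real.sqrt_sq (by positivity), mul_div_cancel₀ _ hn'.ne']

/-- The linear combination of the columns of the matrix with rows `x i`. -/
def columnCombination {n d : ℕ} (x : Fin n → EuclideanSpace ℝ (Fin d)) (c : Fin d → ℝ) :
    EuclideanSpace ℝ (Fin n) :=
  ∑ j, c j • WithLp.toLp 2 fun i : Fin n => x i j

lemma columnCombination_apply {n d : ℕ} (x : Fin n → EuclideanSpace ℝ (Fin d)) (c : Fin d → ℝ)
    (i : Fin n) : columnCombination x c i = ∑ j, c j * x i j := by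
  simp [columnCombination]

lemma mem_columnSpan_iff {n d : ℕ} {x : Fin n → EuclideanSpace ℝ (Fin d)}
    {w : EuclideanSpace ℝ (Fin n)} : w ∈ columnSpan x ↔ ∃ c, columnCombination x c = w :=
  Submodule.mem_span_range_iff_exists_fun ℝ

lemma finrank_columnSpan_le {n d : ℕ} (x : Fin n → EuclideanSpace ℝ (Fin d)) :
    Module.finrank ℝ (columnSpan x) ≤ d :=
  (finrank_range_le_card (R := ℝ) fun j : Fin d => WithLp.toLp 2 fun i : Fin n => x i j).trans
    (by simp)

lemma norm_sq_sub_norm_sub_sq_le {V : Type*} [NormedAddCommGroup V] [InnerProductSpace ℝ V]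
    (v : V) (L : Submodule ℝ V) [L.HasOrthogonalProjection] (w : L) :
    ‖v‖ ^ 2 - ‖v - w‖ ^ 2 ≤ ‖L.orthogonalProjectionOnto v‖ ^ 2 := by
  have hin := (Submodule.inner_orthogonalProjectionOnto_eq_of_mem_right w v)
  have h := sq_nonneg ‖L.orthogonalProjectionOnto v - w‖
  rw [norm_sub_sq_real, hin] at h
  rw [norm_sub_sq_real]
  have : ‖(w : V)‖ = ‖w‖ := rfl
  rw [this]
  linarith

/-- This variational form avoids the span itself, which jumps with the rank of the matrix. It yields
both invariance under sign flips and measurability in `x`. -/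
lemma norm_projection_columnSpan_sq {n d : ℕ} (x : Fin n → EuclideanSpace ℝ (Fin d))
    (v : EuclideanSpace ℝ (Fin n)) :
    ‖(columnSpan x).orthogonalProjectionOnto v‖ ^ 2 =
      ⨆ c : Fin d → ℝ, (‖v‖ ^ 2 - ‖v - columnCombination x c‖ ^ 2) := by
  have hle : ∀ c : Fin d → ℝ, ‖v‖ ^ 2 - ‖v - columnCombination x c‖ ^ 2 ≤
      ‖(columnSpan x).orthogonalProjectionOnto v‖ ^ 2 := fun c =>
    norm_sq_sub_norm_sub_sq_le v (columnSpan x) ⟨_, mem_columnSpan_iff.2 ⟨c, rfl⟩⟩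
  refine le_antisymm ?_ (ciSup_le hle)
  obtain ⟨c, hc⟩ := mem_columnSpan_iff.1 ((columnSpan x).orthogonalProjectionOnto v).2
  refine le_trans (le_of_eq ?_) (le_ciSup ⟨_, by rintro _ ⟨c, rfl⟩; exact hle c⟩ c)
  have hin := Submodule.inner_orthogonalProjectionOnto_eq_of_mem_right
    ((columnSpan x).orthogonalProjectionOnto v) v
  rw [real_inner_self_eq_norm_sq] at hin
  rw [hc, norm_sub_sq_real, ← hin, Submodule.coe_norm]
  ring

lemma norm_projection_columnSpan_sign {n d : ℕ} (x : Fin n → EuclideanSpace ℝ (Fin d))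
    {ε : Fin n → ℝ} (hε : ∀ i, ε i ^ 2 = 1) :
    ‖(columnSpan fun i => ε i • x i).orthogonalProjectionOnto (onesVector n)‖ =
      ‖(columnSpan x).orthogonalProjectionOnto (WithLp.toLp 2 ε)‖ := by
  rw [← sq_eq_sq₀ (norm_nonneg _) (norm_nonneg _), norm_projection_columnSpan_sq,
    norm_projection_columnSpan_sq]
  congr 1
  ext c
  simp only [EuclideanSpace.norm_sq_eq, onesVector, PiLp.sub_apply, columnCombination_apply,
    Real.norm_eq_abs, sq_abs, hε, one_pow, PiLp.smul_apply, smul_eq_mul]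
  congr 1
  refine Finset.sum_congr rfl fun i _ => ?_
  have : ∑ j, c j * (ε i * x i j) = ε i * ∑ j, c j * x i j := by
    rw [Finset.mul_sum]; exact Finset.sum_congr rfl fun j _ => by ring
  rw [this]
  linear_combination (-1 + (∑ j, c j * x i j) ^ 2) * hε i

lemma measurable_norm_projection_columnSpan {n d : ℕ} (v : EuclideanSpace ℝ (Fin n)) :
    Measurable fun x : Fin n → EuclideanSpace ℝ (Fin d) =>
      ‖(columnSpan x).orthogonalProjectionOnto v‖ := by
  have h : Measurable fun x : Fin n → EuclideanSpace ℝ (Fin d) =>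
      ‖(columnSpan x).orthogonalProjectionOnto v‖ ^ 2 := by
    simp only [norm_projection_columnSpan_sq]
    -- The supremum is uncountable; lower semicontinuity is what survives it.
    refine (lowerSemicontinuous_ciSup (fun x => ?_) fun c => ?_).measurable
    · refine ⟨‖v‖ ^ 2, ?_⟩
      rintro _ ⟨c, rfl⟩
      exact sub_le_self _ (sq_nonneg _)
    · apply Continuous.lowerSemicontinuous
      unfold columnCombination
      fun_prop
  simpa only [Real.sqrt_sq (norm_nonneg _)] using h.sqrt

lemma ae_sq_eq_one_pi_signMeasure (n : ℕ) :
    ∀ᵐ ε ∂(Measure.pi fun _ : Fin n => signMeasure), ∀ i, ε i ^ 2 = 1 := by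
  rw [ae_all_iff]
  intro i
  refine (measurePreserving_eval (fun _ : Fin n => signMeasure)
    i).quasiMeasurePreserving.ae (p := fun t : ℝ => t ^ 2 = 1) ?_
  rw [ae_iff, ← lintegral_indicator_one, lintegral_signMeasure]
  · simp
  · measurability

/-! ### Markov's inequality conditionally on the sample -/

lemma signMeasure_tail_le {f : ℝ → ℝ} (hf : C2UpConv f) {u : ℝ} (hu : 0 ≤ u) (hfu : 0 < f u)
    {n d : ℕ} (hn : 1 ≤ n) (x : Fin n → EuclideanSpace ℝ (Fin d)) :
    (Measure.pi fun _ : Fin n => signMeasure)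
        {ε | u ≤ √(n : ℝ) * hotellingR fun i => ε i • x i} ≤
      (∫⁻ x, ENNReal.ofReal (f x) ∂chiMeasure d) / ENNReal.ofReal (f u) := by
  have hfc := hf.differentiable.continuous
  calc _ ≤ (Measure.pi fun _ : Fin n => signMeasure) {ε | ENNReal.ofReal (f u) ≤
        ENNReal.ofReal (f ‖(columnSpan x).orthogonalProjectionOnto (WithLp.toLp 2 ε)‖)} := by
        refine measure_mono_ae ?_
        filter_upwards [ae_sq_eq_one_pi_signMeasure n] with ε hε h
        have h' : u ≤ √(n : ℝ) * hotellingR fun i => ε i • x i := h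
        rw [sqrt_mul_hotellingR hn, norm_projection_columnSpan_sign x hε] at h'
        exact ENNReal.ofReal_le_ofReal (hf.monotoneOn hu (norm_nonneg _) h')
    _ ≤ (∫⁻ ε, ENNReal.ofReal (f ‖(columnSpan x).orthogonalProjectionOnto (WithLp.toLp 2 ε)‖)
        ∂(Measure.pi fun _ : Fin n => signMeasure)) / ENNReal.ofReal (f u) :=
        meas_ge_le_lintegral_div (by fun_prop) (by simpa using hfu) ENNReal.ofReal_ne_top
    _ ≤ _ := by
        gcongr
        exact hf.lintegral_projection_sign_le _ (finrank_columnSpan_le x)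

lemma measure_sqrt_mul_hotellingR_le_Q {Ω : Type*} [MeasurableSpace Ω] {μ : Measure Ω}
    [IsProbabilityMeasure μ] {n d : ℕ} (hn : 1 ≤ n) {X : Fin n → Ω → EuclideanSpace ℝ (Fin d)}
    (hsymm : OrthantSymmetric μ X) {u : ℝ} (hu : 0 ≤ u) :
    μ {ω | u ≤ √(n : ℝ) * hotellingR fun i => X i ω} ≤ Q d u := by
  refine le_iInf fun f => le_iInf fun hf => le_iInf fun hfu => ?_
  set A : Set (Fin n → EuclideanSpace ℝ (Fin d)) := {x | u ≤ √(n : ℝ) * hotellingR x} with hA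
  have hAm : MeasurableSet A := by
    simp only [hA, sqrt_mul_hotellingR hn]
    exact measurableSet_le measurable_const (measurable_norm_projection_columnSpan _)
  have h := hsymm.measure_mem_eq hAm
  have hnull := hsymm.aemeasurable_snd.nullMeasurableSet_preimage hAm
  have hind : AEMeasurable (((fun (p : Ω × (Fin n → ℝ)) i => p.2 i • X i p.1) ⁻¹' A).indicator
      (1 : Ω × (Fin n → ℝ) → ℝ≥0∞)) (μ.prod (Measure.pi fun _ => signMeasure)) :=
    aemeasurable_one.indicator₀ hnull
  change μ ((fun ω i => X i ω) ⁻¹' A) ≤ _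
  rw [h, ← lintegral_indicator_one₀ hnull,
    lintegral_prod _ hind]
  calc _ ≤ ∫⁻ _, (∫⁻ x, ENNReal.ofReal (f x) ∂chiMeasure d) / ENNReal.ofReal (f u) ∂μ := by
        refine lintegral_mono fun ω => ?_
        refine le_trans ?_ (signMeasure_tail_le hf hu hfu hn fun i => X i ω)
        exact lintegral_indicator_one_le {ε : Fin n → ℝ | (fun i => ε i • X i ω) ∈ A}
    _ = _ := by simp

/-! ### Gaussian density and the chi tail -/

section Density

variable {V : Type*} [NormedAddCommGroup V] [InnerProductSpace ℝ V] [FiniteDimensional ℝ V]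
  [MeasurableSpace V] [BorelSpace V]

lemma integral_cexp_gaussian (w : V) :
    ∫ v : V, Complex.exp (-‖v‖ ^ 2 / 2 + Complex.I * ⟪w, v⟫) =
      (∫ v : V, Complex.exp (-‖v‖ ^ 2 / 2)) * Complex.exp (-‖w‖ ^ 2 / 2) := by
  have h1 := GaussianFourier.integral_cexp_neg_mul_sq_norm_add (b := 1 / 2) (by norm_num)
    Complex.I w
  have h0 := GaussianFourier.integral_cexp_neg_mul_sq_norm_add (b := 1 / 2) (by norm_num) 0 w
  have e : ∀ v : V, (-(1 / 2) * (‖v‖ : ℂ) ^ 2) = -(‖v‖ : ℂ) ^ 2 / 2 := fun v => by ring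
  simp only [zero_mul, add_zero, e, ne_eq, OfNat.ofNat_ne_zero, not_false_eq_true, zero_pow,
    zero_div, Complex.exp_zero, mul_one] at h0
  simp only [e] at h1
  rw [h1, h0, Complex.I_sq]
  congr 2
  ring

lemma integrable_exp_neg_norm_sq : Integrable fun v : V => Real.exp (-‖v‖ ^ 2 / 2) := by
  have h := (GaussianFourier.integrable_cexp_neg_mul_sq_norm_add (V := V) (b := 1 / 2)
    (by norm_num) 0 0).re
  refine h.congr (.of_forall fun v => ?_)
  have : (-(1 / 2) * (‖v‖ : ℂ) ^ 2 + 0 * (⟪(0 : V), v⟫ : ℂ)) = ((-‖v‖ ^ 2 / 2 : ℝ) : ℂ) := by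
    push_cast; ring
  simp only [this, ← Complex.ofReal_exp]
  exact Complex.ofReal_re _

lemma integral_exp_neg_norm_sq_pos : 0 < ∫ v : V, Real.exp (-‖v‖ ^ 2 / 2) := by
  rw [integral_pos_iff_support_of_nonneg (fun v => (Real.exp_pos _).le) integrable_exp_neg_norm_sq]
  have : Function.support (fun v : V => Real.exp (-‖v‖ ^ 2 / 2)) = univ := by
    ext v; simp [Real.exp_ne_zero]
  rw [this]
  exact isOpen_univ.measure_pos _ univ_nonempty

lemma stdGaussian_eq_withDensity :
    stdGaussian V = volume.withDensity fun v => ENNReal.ofReal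
      ((∫ v : V, Real.exp (-‖v‖ ^ 2 / 2))⁻¹ * Real.exp (-‖v‖ ^ 2 / 2)) := by
  set Z := ∫ v : V, Real.exp (-‖v‖ ^ 2 / 2) with hZ
  have hZ0 : 0 < Z := integral_exp_neg_norm_sq_pos
  have hint : Integrable fun v : V => Z⁻¹ * Real.exp (-‖v‖ ^ 2 / 2) :=
    integrable_exp_neg_norm_sq.const_mul _
  have := isFiniteMeasure_withDensity_ofReal hint.2
  refine Measure.ext_of_charFun (funext fun t => ?_)
  rw [charFun_stdGaussian, charFun_apply,
    integral_withDensity_eq_integral_toReal_smul (by fun_prop) (by simp)]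
  have e : ∀ v : V, (ENNReal.ofReal (Z⁻¹ * Real.exp (-‖v‖ ^ 2 / 2))).toReal •
      Complex.exp (⟪v, t⟫ * Complex.I) =
      (Z : ℂ)⁻¹ * Complex.exp (-‖v‖ ^ 2 / 2 + Complex.I * ⟪t, v⟫) := fun v => by
    rw [ENNReal.toReal_ofReal (by positivity), Complex.exp_add, Complex.real_smul,
      real_inner_comm]
    push_cast
    rw [mul_comm Complex.I]
    ring
  have hZc : ∫ v : V, Complex.exp (-‖v‖ ^ 2 / 2) = Z := by
    rw [hZ, ← integral_complex_ofReal]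
    push_cast
    rfl
  simp only [e]
  rw [integral_const_mul, integral_cexp_gaussian, hZc, ← mul_assoc,
    inv_mul_cancel₀ (by exact_mod_cast hZ0.ne'), one_mul]

end Density

/-- Polar coordinates. The constant stays implicit because the tangent bound below is homogeneous in
the tail. -/
lemma chiMeasure_real_Ici {d : ℕ} (hd : 1 ≤ d) : ∃ c : ℝ, 0 < c ∧ ∀ u : ℝ, 0 ≤ u →
    (chiMeasure d).real (Ici u) =
      c * ∫ x in Ioi u, x ^ (d - 1) * Real.exp (-x ^ 2 / 2) := by
  set V := EuclideanSpace ℝ (Fin d) with hV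
  have : Nonempty (Fin d) := ⟨⟨0, hd⟩⟩
  have hdim : Module.finrank ℝ V = d := by simp [V]
  set Z := ∫ v : V, Real.exp (-‖v‖ ^ 2 / 2) with hZ
  have hZ0 : 0 < Z := integral_exp_neg_norm_sq_pos
  have hball : 0 < (volume : Measure V).real (Metric.ball 0 1) :=
    ENNReal.toReal_pos (Metric.isOpen_ball.measure_pos _ (by simp)).ne' measure_ball_lt_top.ne
  have hd' : (0 : ℝ) < d := by exact_mod_cast hd
  refine ⟨Z⁻¹ * (d * (volume : Measure V).real (Metric.ball 0 1)), by positivity, fun u hu => ?_⟩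
  have hpre : MeasurableSet ((fun x : V => ‖x‖) ⁻¹' Ici u) := measurable_norm measurableSet_Ici
  rw [chiMeasure_eq_map_norm, map_measureReal_apply (by fun_prop) measurableSet_Ici,
    ← integral_indicator_one hpre, stdGaussian_eq_withDensity,
    integral_withDensity_eq_integral_toReal_smul (by fun_prop) (by simp)]
  have e : ∀ v : V, (ENNReal.ofReal (Z⁻¹ * Real.exp (-‖v‖ ^ 2 / 2))).toReal •
      ((fun x : V => ‖x‖) ⁻¹' Ici u).indicator (1 : V → ℝ) v =
      Z⁻¹ * (Ici u).indicator (fun y => Real.exp (-y ^ 2 / 2)) ‖v‖ := fun v => by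
    rw [ENNReal.toReal_ofReal (by positivity)]
    by_cases h : u ≤ ‖v‖ <;> simp [indicator, h]
  refine (integral_congr_ae (.of_forall e)).trans ?_
  rw [integral_const_mul,
    integral_fun_norm_addHaar volume ((Ici u).indicator fun y => Real.exp (-y ^ 2 / 2)), hdim]
  have e2 : ∀ y : ℝ, y ^ (d - 1) • (Ici u).indicator (fun y => Real.exp (-y ^ 2 / 2)) y =
      (Ici u).indicator (fun y => y ^ (d - 1) * Real.exp (-y ^ 2 / 2)) y := fun y => by
    by_cases h : u ≤ y <;> simp [indicator, h]
  simp only [e2]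
  rw [setIntegral_indicator measurableSet_Ici]
  have hset : (Ioi (0 : ℝ) ∩ Ici u : Set ℝ) =ᵐ[volume] Ioi u := by
    refine ((Filter.EventuallyEq.refl _ _).inter Ioi_ae_eq_Ici.symm).trans ?_
    rw [Ioi_inter_Ioi, max_eq_right hu]
    exact Filter.EventuallyEq.rfl
  rw [setIntegral_congr_set hset]
  simp only [nsmul_eq_mul, smul_eq_mul]
  ring

/-! ### Strict log-concavity of the chi tail -/

section Tail

variable (m : ℕ)

/-- The unnormalized density of the chi distribution. -/
def chiWeight (x : ℝ) : ℝ := x ^ m * Real.exp (-x ^ 2 / 2)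

/-- The unnormalized tail of the chi distribution. -/
def chiTail (u : ℝ) : ℝ := ∫ x in Ioi u, chiWeight m x

lemma continuous_chiWeight : Continuous (chiWeight m) := by
  unfold chiWeight; fun_prop

lemma integrable_chiWeight : Integrable (chiWeight m) := by
  have h := integrable_rpow_mul_exp_neg_mul_sq (b := 1 / 2) (by norm_num) (s := m)
    (by have : (0 : ℝ) ≤ m := by positivity
        linarith)
  refine h.congr (.of_forall fun x => ?_)
  simp only [chiWeight, Real.rpow_natCast]
  congr 2
  ring

variable {m} in
lemma chiWeight_pos {x : ℝ} (hx : 0 < x) : 0 < chiWeight m x := by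
  unfold chiWeight; positivity

lemma hasDerivAt_chiTail (u : ℝ) : HasDerivAt (chiTail m) (-chiWeight m u) u := by
  have h : ∀ x, chiTail m x = chiTail m 0 - ∫ y in (0 : ℝ)..x, chiWeight m y := fun x => by
    have := intervalIntegral.integral_Ioi_sub_Ioi' (a := 0) (b := x)
      (integrable_chiWeight m).integrableOn (integrable_chiWeight m).integrableOn
    unfold chiTail
    linarith
  have hd := ((continuous_chiWeight m).integral_hasStrictDerivAt 0 u).hasDerivAt.const_sub
    (chiTail m 0)
  exact hd.congr_of_eventuallyEq (.of_forall h)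

lemma chiTail_eq_integral_add (x : ℝ) : chiTail m x = ∫ s in Ioi 0, chiWeight m (x + s) := by
  have := (measurePreserving_add_left volume x).setIntegral_preimage_emb
    (measurableEmbedding_addLeft x) (chiWeight m) (Ioi x)
  rw [chiTail, ← this]
  simp

lemma integrableOn_chiWeight_add (x : ℝ) : IntegrableOn (fun s => chiWeight m (x + s)) (Ioi 0) :=
  ((integrable_chiWeight m).comp_add_left x).integrableOn

lemma setIntegral_Ioi_pos {h : ℝ → ℝ} (hi : IntegrableOn h (Ioi 0)) (hp : ∀ s, 0 < s → 0 < h s) :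
    0 < ∫ s in Ioi 0, h s := by
  rw [setIntegral_pos_iff_support_of_nonneg_ae _ hi]
  · refine lt_of_lt_of_le ?_ (measure_mono (s := Ioi (0 : ℝ))
      fun s hs => ⟨(hp s hs).ne', hs⟩)
    simp
  · filter_upwards [ae_restrict_mem measurableSet_Ioi] with s hs using (hp s hs).le

variable {m}

lemma chiTail_pos {x : ℝ} (hx : 0 ≤ x) : 0 < chiTail m x := by
  rw [chiTail_eq_integral_add]
  exact setIntegral_Ioi_pos (integrableOn_chiWeight_add m x)
    fun s hs => chiWeight_pos (by linarith)

/-- The hazard rate of the chi distribution is strictly increasing. -/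
lemma chiWeight_mul_chiTail_lt {x u : ℝ} (hx : 0 ≤ x) (hxu : x < u) :
    chiWeight m x * chiTail m u < chiWeight m u * chiTail m x := by
  rw [chiTail_eq_integral_add, chiTail_eq_integral_add, ← integral_const_mul, ← integral_const_mul,
    ← sub_pos, ← integral_sub ((integrableOn_chiWeight_add m x).const_mul _)
      ((integrableOn_chiWeight_add m u).const_mul _)]
  refine setIntegral_Ioi_pos (((integrableOn_chiWeight_add m x).const_mul _).sub
    ((integrableOn_chiWeight_add m u).const_mul _)) fun s hs => sub_pos.2 ?_
  -- The integrands compare pointwise: `x (u + s) ≤ u (x + s)`, and `x² + (u + s)²` exceeds `u² + (x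
  -- + s)²` by `2 s (u - x)`.
  have e : ∀ a b : ℝ, chiWeight m a * chiWeight m b =
      (a * b) ^ m * Real.exp (-(a ^ 2 + b ^ 2) / 2) := fun a b => by
    unfold chiWeight
    rw [mul_pow, mul_mul_mul_comm, ← Real.exp_add]
    congr 2
    ring
  rw [e, e]
  have hu : 0 < u := by linarith
  have h1 : (x * (u + s)) ^ m ≤ (u * (x + s)) ^ m := by
    gcongr ?_ ^ m
    nlinarith
  have h2 : Real.exp (-(x ^ 2 + (u + s) ^ 2) / 2) < Real.exp (-(u ^ 2 + (x + s) ^ 2) / 2) :=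
    Real.exp_lt_exp.2 (by nlinarith)
  calc _ ≤ (u * (x + s)) ^ m * Real.exp (-(x ^ 2 + (u + s) ^ 2) / 2) := by gcongr
    _ < _ := by gcongr

/-- Strict log-concavity of the chi tail: it lies strictly below its exponential tangent. -/
lemma chiTail_lt_exp {u : ℝ} (hu : 0 < u) {x : ℝ} (hx : 0 ≤ x) (hxu : x ≠ u) :
    chiTail m x < chiTail m u * Real.exp (-(chiWeight m u / chiTail m u) * (x - u)) := by
  set κ := chiWeight m u / chiTail m u with hκ
  -- The derivative of `g` has the sign of `κ` minus the hazard rate, so `g` has its strict maximum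
  -- over `[0, ∞)` at `u`.
  set g : ℝ → ℝ := fun y => chiTail m y * Real.exp (κ * y) with hg
  have hgd : ∀ y, HasDerivAt g ((κ * chiTail m y - chiWeight m y) * Real.exp (κ * y)) y :=
    fun y => by
      have h := (hasDerivAt_chiTail m y).mul (((hasDerivAt_id y).const_mul κ).exp)
      refine h.congr_deriv ?_
      simp only [id]; ring
  have hgc : Continuous g := continuous_iff_continuousAt.2 fun y => (hgd y).continuousAt
  have hTu : 0 < chiTail m u := chiTail_pos hu.le
  have key : g x < g u := by
    rcases hxu.lt_or_gt with h | h
    · have hmono : StrictMonoOn g (Icc 0 u) := by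
        apply strictMonoOn_of_deriv_pos (convex_Icc 0 u) hgc.continuousOn
        intro y hy
        rw [interior_Icc] at hy
        rw [(hgd y).deriv]
        refine mul_pos (sub_pos.2 ?_) (Real.exp_pos _)
        rw [hκ, div_mul_eq_mul_div, lt_div_iff₀ hTu]
        exact chiWeight_mul_chiTail_lt hy.1.le hy.2
      exact hmono ⟨hx, h.le⟩ ⟨hu.le, le_rfl⟩ h
    · have hanti : StrictAntiOn g (Ici u) := by
        apply strictAntiOn_of_deriv_neg (convex_Ici u) hgc.continuousOn
        intro y hy
        rw [interior_Ici] at hy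
        rw [(hgd y).deriv]
        refine mul_neg_of_neg_of_pos (sub_neg.2 ?_) (Real.exp_pos _)
        rw [hκ, div_mul_eq_mul_div, div_lt_iff₀ hTu]
        exact chiWeight_mul_chiTail_lt hu.le hy
      exact hanti (mem_Ici.2 le_rfl) (mem_Ici.2 h.le) h
  have : -κ * (x - u) = κ * u - κ * x := by ring
  rw [this, Real.exp_sub, mul_div_assoc', lt_div_iff₀ (Real.exp_pos _)]
  exact key

end Tail

/-- The chi tail lies strictly below an exponential that touches it at `u`. -/
lemma exists_chiMeasure_real_Ici_lt {d : ℕ} (hd : 1 ≤ d) {u : ℝ} (hu : 0 < u) :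
    ∃ κ : ℝ, 0 < κ ∧ ∀ x, 0 ≤ x → x ≠ u → (chiMeasure d).real (Ici x) <
      (chiMeasure d).real (Ici u) * Real.exp (-κ * (x - u)) := by
  obtain ⟨c, hc, h⟩ := chiMeasure_real_Ici hd
  refine ⟨chiWeight (d - 1) u / chiTail (d - 1) u, div_pos (chiWeight_pos hu) (chiTail_pos hu.le),
    fun x hx hxu => ?_⟩
  rw [h x hx, h u hu.le, mul_assoc]
  exact mul_lt_mul_of_pos_left (chiTail_lt_exp hu hx hxu) hc

lemma ae_nonneg_chiMeasure (d : ℕ) : ∀ᵐ x ∂chiMeasure d, 0 ≤ x := by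
  rw [chiMeasure_eq_map_norm]
  exact (ae_map_iff (by fun_prop) measurableSet_Ici).2 (.of_forall fun x => norm_nonneg x)

/-! ### Truncated moments under an exponential tail bound -/

lemma integral_exp_neg_mul_mul_pow {κ : ℝ} (hκ : 0 < κ) (k : ℕ) :
    ∫ s in Ioi (0 : ℝ), Real.exp (-κ * s) * ((k + 1) * s ^ k) =
      (k + 1).factorial / κ ^ (k + 1) := by
  have h := Real.integral_rpow_mul_exp_neg_mul_Ioi (a := k + 1) (by positivity) hκ
  rw [add_sub_cancel_right, Real.Gamma_nat_eq_factorial] at h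
  simp only [Real.rpow_natCast] at h
  have e : ∀ s : ℝ, Real.exp (-κ * s) * ((k + 1) * s ^ k) =
      (k + 1) * (s ^ k * Real.exp (-(κ * s))) := fun s => by rw [neg_mul]; ring
  simp only [e]
  rw [integral_const_mul, h, Nat.factorial_succ, ← Nat.cast_add_one, Real.rpow_natCast]
  push_cast
  rw [one_div, inv_pow]
  ring

lemma integrableOn_exp_neg_mul_mul_pow {κ : ℝ} (hκ : 0 < κ) (k : ℕ) :
    IntegrableOn (fun s : ℝ => Real.exp (-κ * s) * ((k + 1) * s ^ k)) (Ioi 0) := by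
  -- A non-integrable function would have integral `0`, but the value just computed is positive.
  by_contra h
  have h0 := integral_exp_neg_mul_mul_pow hκ k
  rw [integral_undef h] at h0
  have : (0 : ℝ) < (k + 1).factorial / κ ^ (k + 1) := by positivity
  linarith

/-- A truncated moment of a law whose tail lies below an exponential. -/
lemma lintegral_max_sub_pow_lt {ν : Measure ℝ} [IsFiniteMeasure ν] {u κ t : ℝ} (hκ : 0 < κ)
    (ht : 0 ≤ t) (hν : ∀ x, 0 ≤ x → x ≠ u →
      ν.real (Ici x) < ν.real (Ici u) * Real.exp (-κ * (x - u))) (k : ℕ) :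
    ∫⁻ x, ENNReal.ofReal (max (x - t) 0 ^ (k + 1)) ∂ν <
      ENNReal.ofReal (ν.real (Ici u) * Real.exp (κ * (u - t)) *
        ((k + 1).factorial / κ ^ (k + 1))) := by
  set q := ν.real (Ici u) with hq
  have hq0 : 0 ≤ q := measureReal_nonneg
  have hlayer := lintegral_comp_eq_lintegral_meas_le_mul ν (f := fun x => max (x - t) 0)
    (g := fun s => (k + 1) * s ^ k) (.of_forall fun x => le_max_right _ _) (by fun_prop)
    (fun s _ => Continuous.intervalIntegrable (by fun_prop) _ _) (by
      filter_upwards [ae_restrict_mem measurableSet_Ioi] with s hs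
      have : (0 : ℝ) < s := hs
      positivity)
  have hprim : ∀ x : ℝ, ∫ s in (0 : ℝ)..x, ((k : ℝ) + 1) * s ^ k = x ^ (k + 1) := fun x => by
    rw [intervalIntegral.integral_const_mul, integral_pow]
    have : (k : ℝ) + 1 ≠ 0 := by positivity
    field_simp
    simp
  simp only [hprim] at hlayer
  have hrhs : q * Real.exp (κ * (u - t)) * ((k + 1).factorial / κ ^ (k + 1)) =
      ∫ s in Ioi (0 : ℝ), q * Real.exp (κ * (u - t)) *
        (Real.exp (-κ * s) * ((k + 1) * s ^ k)) := by
    rw [integral_const_mul, integral_exp_neg_mul_mul_pow hκ]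
  rw [hlayer, hrhs, ofReal_integral_eq_lintegral_ofReal
    ((integrableOn_exp_neg_mul_mul_pow hκ k).const_mul _) (by
      filter_upwards [ae_restrict_mem measurableSet_Ioi] with s hs
      have : (0 : ℝ) < s := hs
      simp only [Pi.zero_apply]
      positivity)]
  -- The tail bound is strict except at `s = u - t`, a null set, so strictness survives integration.
  have hlt : ∀ᵐ s ∂volume.restrict (Ioi (0 : ℝ)),
      ν {a | s ≤ max (a - t) 0} * ENNReal.ofReal ((k + 1) * s ^ k) <
      ENNReal.ofReal (q * Real.exp (κ * (u - t)) * (Real.exp (-κ * s) * ((k + 1) * s ^ k))) := by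
    have hne : ∀ᵐ s ∂volume.restrict (Ioi (0 : ℝ)), s ≠ u - t :=
      ae_restrict_of_ae (Measure.ae_ne volume (u - t))
    filter_upwards [hne, ae_restrict_mem measurableSet_Ioi] with s hs hs0
    have hs0' : (0 : ℝ) < s := hs0
    have hset : {a : ℝ | s ≤ max (a - t) 0} = Ici (t + s) := by
      ext a
      simp only [mem_ofPred_eq, mem_Ici, le_max_iff]
      constructor
      · rintro (h | h) <;> linarith
      · intro h; left; linarith
    rw [hset, ← ofReal_measureReal, ← ENNReal.ofReal_mul measureReal_nonneg]
    have hpos : 0 < ((k : ℝ) + 1) * s ^ k := by positivity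
    have h := mul_lt_mul_of_pos_right
      (hν (t + s) (by linarith) (fun h => hs (by linarith))) hpos
    have e : q * Real.exp (-κ * (t + s - u)) * ((k + 1) * s ^ k) =
        q * Real.exp (κ * (u - t)) * (Real.exp (-κ * s) * ((k + 1) * s ^ k)) := by
      have : -κ * (t + s - u) = κ * (u - t) + -κ * s := by ring
      rw [this, Real.exp_add]; ring
    rw [e] at h
    refine (ENNReal.ofReal_lt_ofReal_iff ?_).2 h
    exact lt_of_le_of_lt (mul_nonneg measureReal_nonneg hpos.le) h
  refine lintegral_strict_mono ?_ (by fun_prop) ?_ hlt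
  · simp
  · refine ne_top_of_le_ne_top ?_ (lintegral_mono_ae (hlt.mono fun s hs => hs.le))
    exact (((integrableOn_exp_neg_mul_mul_pow hκ k).const_mul _).lintegral_lt_top).ne

/-! ### Test functions -/

lemma hasDerivAt_max_zero_pow (k : ℕ) (x : ℝ) :
    HasDerivAt (fun x : ℝ => max x 0 ^ (k + 2)) ((k + 2 : ℕ) * max x 0 ^ (k + 1)) x := by
  have hp : ∀ y : ℝ, HasDerivAt (fun x : ℝ => x ^ (k + 2)) ((k + 2 : ℕ) * y ^ (k + 1)) y :=
    fun y => hasDerivAt_pow (k + 2) y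
  rcases lt_trichotomy x 0 with h | rfl | h
  · rw [max_eq_right h.le]
    refine ((hasDerivAt_const x (0 : ℝ)).congr_of_eventuallyEq ?_).congr_deriv (by simp)
    filter_upwards [Iio_mem_nhds h] with y hy
    rw [max_eq_right (le_of_lt hy)]; simp
  · have h1 : HasDerivWithinAt (fun x : ℝ => max x 0 ^ (k + 2)) 0 (Iic 0) 0 :=
      (hasDerivWithinAt_const (0 : ℝ) _ (0 : ℝ)).congr
        (fun y hy => by rw [max_eq_right (mem_Iic.1 hy)]; simp) (by simp)
    have h2 : HasDerivWithinAt (fun x : ℝ => max x 0 ^ (k + 2)) 0 (Ici 0) 0 :=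
      ((hp 0).hasDerivWithinAt.congr_deriv (by simp)).congr
        (fun y hy => by rw [max_eq_left (mem_Ici.1 hy)]) (by simp)
    have h3 := h1.union h2
    rw [Iic_union_Ici, hasDerivWithinAt_univ] at h3
    exact h3.congr_deriv (by simp)
  · rw [max_eq_left h.le]
    refine (hp x).congr_of_eventuallyEq ?_
    filter_upwards [Ioi_mem_nhds h] with y hy
    rw [max_eq_left (le_of_lt hy)]

lemma convexOn_max_sub (t : ℝ) : ConvexOn ℝ univ fun x : ℝ => max (x - t) 0 :=
  ((convexOn_id convex_univ).sub (concaveOn_const t convex_univ)).sup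
    (convexOn_const 0 convex_univ)

lemma convexOn_max_neg_sub (t : ℝ) : ConvexOn ℝ univ fun x : ℝ => max (-x - t) 0 :=
  ((concaveOn_id convex_univ).neg.sub (concaveOn_const t convex_univ)).sup
    (convexOn_const 0 convex_univ)

lemma C2UpConv.const_one : C2UpConv fun _ => (1 : ℝ) where
  toC2Conv := C2Conv.of_hasDerivAt (f₁ := fun _ => 0) (f₂ := fun _ => 0) (fun _ => rfl)
    (fun x => hasDerivAt_const x _) (fun x => hasDerivAt_const x _) (convexOn_const 0 convex_univ)
  convexOn := convexOn_const 1 (convex_Ici 0)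
  nonneg _ := zero_le_one

lemma C2UpConv.sq : C2UpConv fun x => x ^ 2 where
  toC2Conv := C2Conv.of_hasDerivAt (f₁ := fun x => 2 * x) (f₂ := fun _ => 2) (fun x => neg_sq x)
    (fun x => by simpa using hasDerivAt_pow 2 x)
    (fun x => by simpa using (hasDerivAt_id x).const_mul (2 : ℝ))
    (convexOn_const 2 convex_univ)
  convexOn := (even_two.convexOn_pow).subset (subset_univ _) (convex_Ici 0)
  nonneg x := sq_nonneg x

/-- The symmetrized truncated cube. -/
lemma C2UpConv.truncated_cube (t : ℝ) :
    C2UpConv fun x => max (x - t) 0 ^ 3 + max (-x - t) 0 ^ 3 where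
  toC2Conv := by
    have hs : ∀ x : ℝ, HasDerivAt (fun x => x - t) 1 x := fun x => (hasDerivAt_id x).sub_const t
    have hn : ∀ x : ℝ, HasDerivAt (fun x => -x - t) (-1) x := fun x =>
      (hasDerivAt_id x).neg.sub_const t
    refine C2Conv.of_hasDerivAt
      (f₁ := fun x => 3 * max (x - t) 0 ^ 2 - 3 * max (-x - t) 0 ^ 2)
      (f₂ := fun x => 6 * (max (x - t) 0 + max (-x - t) 0)) (fun x => ?_) (fun x => ?_)
      (fun x => ?_) (((convexOn_max_sub t).add (convexOn_max_neg_sub t)).smul (by norm_num))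
    · rw [neg_neg, add_comm]
    · refine (((hasDerivAt_max_zero_pow 1 _).comp x (hs x)).add
        ((hasDerivAt_max_zero_pow 1 _).comp x (hn x))).congr_deriv ?_
      norm_num
      ring
    · refine ((((hasDerivAt_max_zero_pow 0 _).comp x (hs x)).const_mul 3).sub
        (((hasDerivAt_max_zero_pow 0 _).comp x (hn x)).const_mul 3)).congr_deriv ?_
      norm_num
      ring
  convexOn := (((convexOn_max_sub t).pow (fun _ _ => le_max_right _ _) 3).add
    ((convexOn_max_neg_sub t).pow (fun _ _ => le_max_right _ _) 3)).subset
      (subset_univ _) (convex_Ici 0)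
  nonneg x := by positivity

/-! ### The constant `2 e³ / 9` -/

lemma Q_lt_of_lintegral_lt {d : ℕ} {u C B : ℝ} (hC : 0 ≤ C) {f : ℝ → ℝ} (hf : C2UpConv f)
    (hfu : 0 < f u) (hB : ∫⁻ x, ENNReal.ofReal (f x) ∂chiMeasure d < ENNReal.ofReal B)
    (h : B ≤ C * (chiMeasure d).real (Ici u) * f u) :
    Q d u < ENNReal.ofReal C * chiMeasure d (Ici u) := by
  have hQ : Q d u ≤ (∫⁻ x, ENNReal.ofReal (f x) ∂chiMeasure d) / ENNReal.ofReal (f u) := by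
    unfold Q
    exact iInf_le_of_le f (iInf_le_of_le hf (iInf_le_of_le hfu le_rfl))
  refine hQ.trans_lt (ENNReal.div_lt_of_lt_mul (hB.trans_le ?_))
  rw [← ofReal_measureReal, ← ENNReal.ofReal_mul hC,
    ← ENNReal.ofReal_mul (mul_nonneg hC measureReal_nonneg)]
  exact ENNReal.ofReal_le_ofReal h

/-- `5.0625 = (9/4)²` is what the square test function needs at `y = 4/3`; the constant one needs
only `9/2`. -/
lemma exp_five_thirds_gt : 5.0625 < Real.exp (5 / 3) := by
  have h : (5.0625 : ℝ) ^ 3 < Real.exp (5 / 3) ^ 3 := by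
    rw [← Real.exp_nat_mul]
    have e : ((3 : ℕ) : ℝ) * (5 / 3) = ((5 : ℕ) : ℝ) * 1 := by norm_num
    rw [e, Real.exp_nat_mul]
    calc (5.0625 : ℝ) ^ 3 < 2.7 ^ 5 := by norm_num
      _ ≤ Real.exp 1 ^ 5 := by
        have := Real.exp_one_gt_d9
        gcongr
        linarith
  exact lt_of_pow_lt_pow_left₀ 3 (Real.exp_pos _).le h

/-- After a square root this reads `3 exp ((y - 3) / 2) ≤ y`, a convex function against a line, so
the endpoints suffice; equality holds at `y = 3`. -/
lemma nine_mul_exp_le {y : ℝ} (h1 : 4 / 3 ≤ y) (h2 : y ≤ 3) :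
    9 * Real.exp y ≤ y ^ 2 * Real.exp 3 := by
  have hend : 3 * Real.exp (-(5 / 6)) ≤ 4 / 3 := by
    rw [Real.exp_neg, ← div_eq_mul_inv, div_le_iff₀ (Real.exp_pos _)]
    have : 2.25 < Real.exp (5 / 6) := by
      refine lt_of_pow_lt_pow_left₀ 2 (Real.exp_pos _).le ?_
      rw [← Real.exp_nat_mul]
      have := exp_five_thirds_gt
      norm_num at this ⊢
      exact this
    linarith
  have hmid : 3 * Real.exp ((y - 3) / 2) ≤ y := by
    have hc := convexOn_exp.2 (mem_univ (-(5 / 6))) (mem_univ 0)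
      (by linarith : 0 ≤ (3 - y) * (3 / 5)) (by linarith : 0 ≤ (y - 4 / 3) * (3 / 5)) (by ring)
    simp only [smul_eq_mul, Real.exp_zero] at hc
    have e : (3 - y) * (3 / 5) * -(5 / 6) + (y - 4 / 3) * (3 / 5) * 0 = (y - 3) / 2 := by ring
    rw [e] at hc
    nlinarith
  have hsq := pow_le_pow_left₀ (by positivity) hmid 2
  have e : Real.exp y = Real.exp ((y - 3) / 2) ^ 2 * Real.exp 3 := by
    rw [← Real.exp_nat_mul, ← Real.exp_add]
    congr 1
    push_cast
    ring
  rw [e]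
  have := mul_le_mul_of_nonneg_right hsq (Real.exp_pos 3).le
  linarith

lemma Q_lt {d : ℕ} (hd : 1 ≤ d) {u : ℝ} (hu : 0 ≤ u) :
    Q d u < ENNReal.ofReal (2 * Real.exp 3 / 9) * chiMeasure d (Ici u) := by
  have hC : 0 ≤ 2 * Real.exp 3 / 9 := by positivity
  have hone : ∀ x : ℝ, x ≤ 0 → (chiMeasure d).real (Ici x) = 1 := fun x hx => by
    rw [measureReal_def, (prob_compl_eq_zero_iff measurableSet_Ici).1, ENNReal.toReal_one]
    exact ae_iff.1 ((ae_nonneg_chiMeasure d).mono fun y hy => hx.trans hy)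
  -- the constant function settles every case in which the tail is not too small
  have hconst : 1 < 2 * Real.exp 3 / 9 * (chiMeasure d).real (Ici u) →
      Q d u < ENNReal.ofReal (2 * Real.exp 3 / 9) * chiMeasure d (Ici u) := fun h =>
    Q_lt_of_lintegral_lt hC C2UpConv.const_one one_pos
      (B := 2 * Real.exp 3 / 9 * (chiMeasure d).real (Ici u))
      (by simpa using h) (by rw [mul_one])
  have he := exp_five_thirds_gt
  rcases hu.eq_or_lt with rfl | hu
  · refine hconst ?_
    rw [hone 0 le_rfl]
    have : Real.exp (5 / 3) < Real.exp 3 := Real.exp_lt_exp.2 (by norm_num)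
    norm_num at he
    linarith
  obtain ⟨κ, hκ, hν⟩ := exists_chiMeasure_real_Ici_lt hd hu
  set q := (chiMeasure d).real (Ici u) with hq
  have hq0 : 0 ≤ q := measureReal_nonneg
  have h0 := hν 0 le_rfl hu.ne
  rw [hone 0 le_rfl] at h0
  have e0 : -κ * (0 - u) = κ * u := by ring
  rw [e0] at h0
  rcases le_total (κ * u) (4 / 3) with hy | hy
  · refine hconst ?_
    have h1 : Real.exp (κ * u) ≤ Real.exp (4 / 3) := Real.exp_le_exp.2 hy
    have h2 : 1 < q * Real.exp (4 / 3) := h0.trans_le (by gcongr)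
    have h3 : Real.exp 3 = Real.exp (4 / 3) * Real.exp (5 / 3) := by
      rw [← Real.exp_add]; norm_num
    rw [h3]
    norm_num at he
    nlinarith
  rcases le_total (κ * u) 3 with hy3 | hy3
  · have hmom := lintegral_max_sub_pow_lt hκ le_rfl hν 1
    refine Q_lt_of_lintegral_lt hC C2UpConv.sq (by positivity) (lt_of_le_of_lt (le_of_eq ?_) hmom)
      ?_
    · refine lintegral_congr_ae ((ae_nonneg_chiMeasure d).mono fun x hx => ?_)
      simp only [sub_zero, max_eq_left hx]
    · have h9 := nine_mul_exp_le hy hy3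
      have : ((1 + 1 : ℕ).factorial : ℝ) = 2 := by norm_num [Nat.factorial]
      rw [← hq, sub_zero, this, mul_div_assoc', div_le_iff₀ (by positivity)]
      have := mul_le_mul_of_nonneg_left h9 hq0
      norm_num
      nlinarith
  -- With `y = κ (u - t)` the cube gives the ratio `6 exp y / y³`, minimal at `y = 3`. The resulting
  -- `t = u - 3 / κ` is nonnegative exactly when `κ u ≥ 3`, and then the mirrored cube vanishes on
  -- `[0, ∞)`.
  · have ht : 0 ≤ u - 3 / κ := by
      rw [sub_nonneg, div_le_iff₀ hκ]; linarith
    have hmom := lintegral_max_sub_pow_lt hκ ht hν 2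
    have h3κ : 0 < 3 / κ := by positivity
    have hfu : max (u - (u - 3 / κ)) 0 ^ 3 + max (-u - (u - 3 / κ)) 0 ^ 3 = (3 / κ) ^ 3 := by
      rw [sub_sub_cancel, max_eq_left h3κ.le, max_eq_right (by linarith)]
      simp
    refine Q_lt_of_lintegral_lt hC (C2UpConv.truncated_cube (u - 3 / κ)) ?_
      (lt_of_le_of_lt (le_of_eq ?_) hmom) ?_
    · rw [hfu]; positivity
    · refine lintegral_congr_ae ((ae_nonneg_chiMeasure d).mono fun x hx => ?_)
      simp only
      rw [max_eq_right (by linarith : -x - (u - 3 / κ) ≤ 0)]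
      simp
    · have e3 : κ * (u - (u - 3 / κ)) = 3 := by field_simp; ring
      have : ((2 + 1 : ℕ).factorial : ℝ) = 6 := by norm_num [Nat.factorial]
      rw [hfu, ← hq, e3, this]
      refine le_of_eq ?_
      field_simp
      ring

end Hotelling
end

theorem theorem6p2 {Ω : Type*} [MeasurableSpace Ω] (μ : MeasureTheory.Measure Ω)
    [MeasureTheory.IsProbabilityMeasure μ] (n d : ℕ) (hn : 1 ≤ n) (hd : 1 ≤ d)
    (X : Fin n → Ω → EuclideanSpace ℝ (Fin d)) (hX : ∀ i, AEMeasurable (X i) μ)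
    (hsymm : Hotelling.OrthantSymmetric μ X) (u : ℝ) (hu : 0 ≤ u) :
    μ {ω | u ≤ √(n : ℝ) * Hotelling.hotellingR (fun i => X i ω)} ≤ Hotelling.Q d u ∧
      Hotelling.Q d u <
        ENNReal.ofReal (2 * Real.exp 3 / 9) * Hotelling.chiMeasure d (Set.Ici u) :=
  ⟨Hotelling.measure_sqrt_mul_hotellingR_le_Q hn hsymm hu, Hotelling.Q_lt hd hu⟩
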